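/- Let $F,\beta\in\mathbb R$ with $F\beta\neq0$, and consider the two-layer quasi-geostrophic system for $\psi^1,\psi^2$ as functions of $(t,x,y)$: \[ Q^1_t+\psi^1_xQ^1_y-\psi^1_yQ^1_x=0,\qquad Q^2_t+\psi^2_xQ^2_y-\psi^2_yQ^2_x=0, \] \[ Q^1=\psi^1_{xx}+\psi^1_{yy}+\beta y-F(\psi^1-\psi^2),\qquad Q^2=\psi^2_{xx}+\psi^2_{yy}+\beta y+F(\psi^1-\psi^2). \] A smooth vector field $v=\xi^t\partial_t+\xi^x\partial_x+\xi^y\partial_y+\eta^1\partial_{\psi^1}+\eta^2\partial_{\psi^2}$ on $\mathbb R^5$ (with coefficients depending on $t,x,y,\psi^1,\psi^2$) is called a Lie symmetry of the system if its prolongation to the jet space annihilates the left-hand sides of both equations at every jet that satisfies both equations. Here the coefficient of the prolongation along the jet coordinate $\psi^a_J$ is $D_J\bigl(\eta^a-\sum_i\xi^i\psi^a_i\bigr)+\sum_i\xi^i\psi^a_{J,i}$, where $i$ runs over $t,x,y$ and $D_J$ denotes the iterated total derivative. Then the set $\mathfrak g$ of all Lie symmetries of the system (its maximal Lie invariance algebra)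 is a Lie subalgebra of the Lie algebra of smooth vector fields on $\mathbb R^5$ with the commutator. It is the real linear span of the vector fields \[ \partial_t,\quad \partial_y,\quad \mathcal X(f)=f(t)\partial_x-f'(t)\,y\,(\partial_{\psi^1}+\partial_{\psi^2}),\quad \mathcal F=\partial_{\psi^1}-\partial_{\psi^2},\quad \mathcal Z(g)=g(t)(\partial_{\psi^1}+\partial_{\psi^2}), \] where $f$ and $g$ run through all smooth functions $\mathbb R\to\mathbb R$. Every element of $\mathfrak g$ can be written as $a\partial_t+b\partial_y+c\mathcal F+\mathcal X(f)+\mathcal Z(g)$ with unique $a,b,c\in\mathbb R$ and unique smooth functions $f,g$. Moreover, $\mathfrak g$ is infinite-dimensional and solvable. -/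

import Mathlib

open scoped ContDiff

noncomputable section

namespace TwoLayer

/-! ### Vector fields on the space of independent and dependent variables -/

/-- The space `ℝ³ × ℝ²` with coordinates `((t, x, y), (ψ¹, ψ²))`. -/
abbrev Space : Type := (Fin 3 → ℝ) × (Fin 2 → ℝ)

/-- The real vector space of smooth vector fields
`ξᵗ ∂_t + ξˣ ∂_x + ξʸ ∂_y + η¹ ∂_{ψ¹} + η² ∂_{ψ²}` on `Space`. The field `v` has the coefficients
`((v p).1 0, (v p).1 1, (v p).1 2) = (ξᵗ, ξˣ, ξʸ)` and `((v p).2 0, (v p).2 1) = (η¹, η²)`. -/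
def smoothFields : Submodule ℝ (Space → Space) where
  carrier := {v | ContDiff ℝ ∞ v}
  add_mem' hv hw := Set.mem_ofPred.2 (ContDiff.add (Set.mem_ofPred.1 hv) (Set.mem_ofPred.1 hw))
  zero_mem' := Set.mem_ofPred.2 contDiff_const
  smul_mem' c _ hv := Set.mem_ofPred.2 (ContDiff.const_smul c (Set.mem_ofPred.1 hv))

theorem mem_smoothFields {v : Space → Space} : v ∈ smoothFields ↔ ContDiff ℝ ∞ v := Iff.rfl

/-- Smooth vector fields on `Space`. -/
abbrev VField : Type := smoothFields

theorem VField.contDiff (v : VField) : ContDiff ℝ ∞ (v : Space → Space) :=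
  mem_smoothFields.1 v.2

theorem VField.differentiableAt (v : VField) (p : Space) :
    DifferentiableAt ℝ (v : Space → Space) p :=
  (v.contDiff.differentiable (by simp)).differentiableAt

/-- The commutator of vector fields. -/
instance : Bracket VField VField where
  bracket v w := ⟨VectorField.lieBracket ℝ (v : Space → Space) (w : Space → Space),
    mem_smoothFields.2 (ContDiff.lieBracket_vectorField (m := ∞) (n := ∞) v.contDiff w.contDiff
      (by simp))⟩

theorem VField.bracket_apply (v w : VField) (p : Space) :
    (⁅v, w⁆ : VField).1 p = VectorField.lieBracket ℝ (v : Space → Space) (w : Space → Space) p :=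
  rfl

instance : LieRing VField where
  add_lie u v w := by
    ext1; funext p
    exact VectorField.lieBracket_add_left (u.differentiableAt p) (v.differentiableAt p)
  lie_add u v w := by
    ext1; funext p
    exact VectorField.lieBracket_add_right (v.differentiableAt p) (w.differentiableAt p)
  lie_self v := by
    ext1
    exact VectorField.lieBracket_self
  leibniz_lie u v w := by
    ext1; funext p
    exact VectorField.leibniz_identity_lieBracket (n := ∞)
      (by simpa using WithTop.coe_le_coe.2 (le_top : (2 : ℕ∞) ≤ ⊤))
      u.contDiff.contDiffAt v.contDiff.contDiffAt w.contDiff.contDiffAt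

instance : LieAlgebra ℝ VField where
  lie_smul c v w := by
    ext1; funext p
    exact VectorField.lieBracket_const_smul_right (w.differentiableAt p)

/-! ### Jets, total derivatives and prolongation -/

/-- The space of jets of pairs of functions of `(t, x, y)`. A jet `j` has the independent
coordinates `j.1 = (t, x, y)`, and `j.2 a J` is the coordinate `ψᵃ_J` that stands for the
derivative of `ψᵃ` of order `J 0` in `t`, `J 1` in `x` and `J 2` in `y`.
The functions on it that are used below depend on finitely many coordinates only. -/
abbrev Jet : Type := (Fin 3 → ℝ) × (Fin 2 → (Fin 3 → ℕ) → ℝ)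

/-- The point `(t, x, y, ψ¹, ψ²)` below a jet. -/
def Jet.base (j : Jet) : Space := (j.1, fun a => j.2 a 0)

/-- The multi-index `J` raised by one in the direction `i`. -/
def raise (J : Fin 3 → ℕ) (i : Fin 3) : Fin 3 → ℕ := J + Pi.single i 1

/-- The total derivative
`D_i P = ∂P/∂zᵢ + ∑_{a, J} ψᵃ_{J,i} ∂P/∂ψᵃ_J`, where `(z₀, z₁, z₂) = (t, x, y)`,
of a function on the jet space. -/
def totalDeriv (i : Fin 3) (P : Jet → ℝ) (j : Jet) : ℝ :=
  lineDeriv ℝ P j (Pi.single i 1, fun a J => j.2 a (raise J i))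

/-- The iterated total derivative `D_J = D_t^{J 0} D_x^{J 1} D_y^{J 2}`. -/
def totalDerivMulti (J : Fin 3 → ℕ) (P : Jet → ℝ) : Jet → ℝ :=
  (totalDeriv 0)^[J 0] ((totalDeriv 1)^[J 1] ((totalDeriv 2)^[J 2] P))

/-- The characteristic `ηᵃ - ∑ᵢ ξⁱ ψᵃ_i` of a vector field. -/
def characteristic (v : VField) (a : Fin 2) (j : Jet) : ℝ :=
  (v.1 j.base).2 a - ∑ i, (v.1 j.base).1 i * j.2 a (raise 0 i)

/-- The prolongation of a vector field to the jet space: its component along `ψᵃ_J` is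
`D_J (ηᵃ - ∑ᵢ ξⁱ ψᵃ_i) + ∑ᵢ ξⁱ ψᵃ_{J,i}`. -/
def prolongation (v : VField) (j : Jet) : Jet :=
  ((v.1 j.base).1, fun a J => totalDerivMulti J (characteristic v a) j
    + ∑ i, (v.1 j.base).1 i * j.2 a (raise J i))

/-! ### The two-layer system -/

/-- The potential vorticities `Q¹ = ψ¹_xx + ψ¹_yy + β y - F (ψ¹ - ψ²)` and
`Q² = ψ²_xx + ψ²_yy + β y + F (ψ¹ - ψ²)`. -/
def potentialVorticity (F β : ℝ) (a : Fin 2) (j : Jet) : ℝ :=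
  j.2 a ![0, 2, 0] + j.2 a ![0, 0, 2] + β * j.1 2
    + (![-F, F] : Fin 2 → ℝ) a * (j.2 0 0 - j.2 1 0)

/-- The left-hand sides `Qᵃ_t + ψᵃ_x Qᵃ_y - ψᵃ_y Qᵃ_x` of the two-layer system. -/
def system (F β : ℝ) (a : Fin 2) (j : Jet) : ℝ :=
  totalDeriv 0 (potentialVorticity F β a) j
    + (j.2 a ![0, 1, 0] * totalDeriv 2 (potentialVorticity F β a) j
      - j.2 a ![0, 0, 1] * totalDeriv 1 (potentialVorticity F β a) j)

/-- The infinitesimal invariance criterion: the prolongation of `v` annihilates the left-hand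
sides of the system at every jet that satisfies the system. -/
def IsLieSymmetry (F β : ℝ) (v : VField) : Prop :=
  ∀ j : Jet, (∀ a, system F β a j = 0) →
    ∀ a, lineDeriv ℝ (system F β a) j (prolongation v j) = 0

/-! ### The generators -/

/-- The real vector space of smooth functions of `t`. -/
def smoothFunctions : Submodule ℝ (ℝ → ℝ) where
  carrier := {f | ContDiff ℝ ∞ f}
  add_mem' hf hg := Set.mem_ofPred.2 (ContDiff.add (Set.mem_ofPred.1 hf) (Set.mem_ofPred.1 hg))
  zero_mem' := Set.mem_ofPred.2 contDiff_const
  smul_mem' c _ hf := Set.mem_ofPred.2 (ContDiff.const_smul c (Set.mem_ofPred.1 hf))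

theorem mem_smoothFunctions {f : ℝ → ℝ} : f ∈ smoothFunctions ↔ ContDiff ℝ ∞ f := Iff.rfl

/-- `∂_t` -/
def fieldT : VField := ⟨fun _ => (![1, 0, 0], ![0, 0]), mem_smoothFields.2 contDiff_const⟩

/-- `∂_y` -/
def fieldY : VField := ⟨fun _ => (![0, 0, 1], ![0, 0]), mem_smoothFields.2 contDiff_const⟩

/-- `∂_{ψ¹} - ∂_{ψ²}` -/
def fieldF : VField := ⟨fun _ => (![0, 0, 0], ![1, -1]), mem_smoothFields.2 contDiff_const⟩

/-- `f(t) ∂_x - f'(t) y (∂_{ψ¹} + ∂_{ψ²})` -/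
def fieldX (f : smoothFunctions) : VField :=
  ⟨fun p => (![0, f.1 (p.1 0), 0], ![-(deriv f.1 (p.1 0) * p.1 2), -(deriv f.1 (p.1 0) * p.1 2)]),
    by
      have hf : ContDiff ℝ ∞ f.1 := mem_smoothFunctions.1 f.2
      have hf' : ContDiff ℝ ∞ (deriv f.1) := (contDiff_infty_iff_deriv.1 hf).2
      have h0 : ContDiff ℝ ∞ fun p : Space => p.1 0 := by fun_prop
      have h2 : ContDiff ℝ ∞ fun p : Space => p.1 2 := by fun_prop
      have h := ((hf'.comp h0).mul h2).neg
      refine mem_smoothFields.2 (ContDiff.prodMk (contDiff_pi.2 fun i => ?_) (contDiff_pi.2 fun a => ?_))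
      · fin_cases i
        · exact contDiff_const
        · exact hf.comp h0
        · exact contDiff_const
      · fin_cases a
        · exact h
        · exact h⟩

/-- `g(t) (∂_{ψ¹} + ∂_{ψ²})` -/
def fieldZ (g : smoothFunctions) : VField :=
  ⟨fun p => (![0, 0, 0], ![g.1 (p.1 0), g.1 (p.1 0)]), by
      have hg : ContDiff ℝ ∞ g.1 := mem_smoothFunctions.1 g.2
      have h0 : ContDiff ℝ ∞ fun p : Space => p.1 0 := by fun_prop
      refine mem_smoothFields.2 (ContDiff.prodMk contDiff_const (contDiff_pi.2 fun a => ?_))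
      fin_cases a
      · exact hg.comp h0
      · exact hg.comp h0⟩

end TwoLayer

end

noncomputable section

namespace TwoLayer

/-! ### Calculus of total derivatives -/

/-! That the listed fields are symmetries is a computation: their prolongation is explicit, and its
terms cancel in the linearized system (`isLieSymmetry_normalForm`).

For the converse it suffices to evaluate the criterion at special jets. The equations contain only
coordinates of orders one and three, and affinely those of order three. At a `testJet` the
coordinates of orders two and four vanish, so a third order component of the prolongation splits
into a part linear in the third order coordinates (`testTop`) and a part free of them (`testLow`).
Subtracting the criterion at two solution jets with the same first order part leaves the linear part
alone (`IsLieSymmetry.top`). Suitable choices of a few nonzero coordinates then give: `ξ` is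
independent of `ψ`, `ξᵗ` depends on `t` only, `ηᵃ` ignores the other layer, `(ξˣ, ξʸ)` satisfies the
planar conformal equations, and `ηᵃ_x = ξʸ_t`, `ηᵃ_y = -ξˣ_t`, `∂ηᵃ/∂ψᵃ = 2 ξˣ_x - ξᵗ_t`.

The remaining freedom is removed by the terms of lower order (`IsLieSymmetry.test`). The coupling
`F` fixes a length scale and excludes dilations. The term `β` excludes time scaling and rotations.
Finally `β ξʸ_t = F (ηᵃ_t - ηᵇ_t)` is symmetric on the left and antisymmetric on the right under
exchange of the layers, so both sides vanish. Hence `ξᵗ` and `ξʸ` are constant, `ξˣ = f(t)`, and `ηᵃ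
+ f'(t) y` depends on `t` only, with a constant difference between the layers; integration along
lines yields the normal form (`IsLieSymmetry.exists_normalForm`).

Commutators of normal forms lie in the span of the fields `𝓧(f)` and `𝓩(g)`, which commute with each
other. This gives solvability; the fields `𝓩(g)` alone give infinite dimension. -/

/-- The direction of the total derivative `D_i` at a jet. -/
def shift (i : Fin 3) (j : Jet) : Jet := (Pi.single i 1, fun a J => j.2 a (raise J i))

/-- `P'` is the total derivative of `P` in the direction `i`, in the strong sense. -/
def IsTotalDeriv (i : Fin 3) (P P' : Jet → ℝ) : Prop :=
  ∀ j, HasLineDerivAt ℝ P (P' j) j (shift i j)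

/-- `lineDeriv` has the default value `0` where no derivative exists, so sum and product rules are
proved for `IsTotalDeriv`, which includes existence, and transferred to `totalDeriv` only here. -/
theorem IsTotalDeriv.eq {i : Fin 3} {P P' : Jet → ℝ} (h : IsTotalDeriv i P P') :
    totalDeriv i P = P' :=
  funext fun j => (h j).lineDeriv

theorem IsTotalDeriv.congr {i : Fin 3} {P P' Q : Jet → ℝ} (h : IsTotalDeriv i P P')
    (hQ : ∀ j, P' j = Q j) : IsTotalDeriv i P Q :=
  (funext hQ : P' = Q) ▸ h

theorem IsTotalDeriv.add {i : Fin 3} {P P' Q Q' : Jet → ℝ} (hP : IsTotalDeriv i P P')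
    (hQ : IsTotalDeriv i Q Q') :
    IsTotalDeriv i (fun j => P j + Q j) (fun j => P' j + Q' j) :=
  fun j => HasDerivAt.fun_add (hP j) (hQ j)

theorem IsTotalDeriv.sub {i : Fin 3} {P P' Q Q' : Jet → ℝ} (hP : IsTotalDeriv i P P')
    (hQ : IsTotalDeriv i Q Q') :
    IsTotalDeriv i (fun j => P j - Q j) (fun j => P' j - Q' j) :=
  fun j => HasDerivAt.fun_sub (hP j) (hQ j)

theorem IsTotalDeriv.mul {i : Fin 3} {P P' Q Q' : Jet → ℝ} (hP : IsTotalDeriv i P P')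
    (hQ : IsTotalDeriv i Q Q') :
    IsTotalDeriv i (fun j => P j * Q j) (fun j => P' j * Q j + P j * Q' j) := fun j => by
  have h := HasDerivAt.fun_mul (hP j) (hQ j)
  simp only [zero_smul, add_zero] at h
  exact h

theorem IsTotalDeriv.sum {ι : Type*} {i : Fin 3} {s : Finset ι} {P P' : ι → Jet → ℝ}
    (h : ∀ m ∈ s, IsTotalDeriv i (P m) (P' m)) :
    IsTotalDeriv i (fun j => ∑ m ∈ s, P m j) (fun j => ∑ m ∈ s, P' m j) :=
  fun j => HasDerivAt.fun_sum fun m hm => h m hm j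

theorem isTotalDeriv_const (i : Fin 3) (c : ℝ) : IsTotalDeriv i (fun _ => c) (fun _ => 0) :=
  fun _ => hasDerivAt_const _ _

theorem IsTotalDeriv.const_mul {i : Fin 3} {P P' : Jet → ℝ} (c : ℝ) (hP : IsTotalDeriv i P P') :
    IsTotalDeriv i (fun j => c * P j) (fun j => c * P' j) :=
  fun j => HasDerivAt.const_mul c (hP j)

theorem hasLineDerivAt_coord (a : Fin 2) (J : Fin 3 → ℕ) (j d : Jet) :
    HasLineDerivAt ℝ (fun j : Jet => j.2 a J) (d.2 a J) j d := by
  have h := ((hasDerivAt_id (0 : ℝ)).mul_const (d.2 a J)).const_add (j.2 a J)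
  simpa [HasLineDerivAt] using h

theorem hasLineDerivAt_indep (i : Fin 3) (j d : Jet) :
    HasLineDerivAt ℝ (fun j : Jet => j.1 i) (d.1 i) j d := by
  have h := ((hasDerivAt_id (0 : ℝ)).mul_const (d.1 i)).const_add (j.1 i)
  simpa [HasLineDerivAt] using h

theorem isTotalDeriv_coord (i : Fin 3) (a : Fin 2) (J : Fin 3 → ℕ) :
    IsTotalDeriv i (fun j => j.2 a J) (fun j => j.2 a (raise J i)) :=
  fun j => hasLineDerivAt_coord a J j (shift i j)

theorem isTotalDeriv_indep (i k : Fin 3) :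
    IsTotalDeriv i (fun j => j.1 k) (fun _ => (Pi.single i 1 : Fin 3 → ℝ) k) :=
  fun j => hasLineDerivAt_indep k j (shift i j)

/-- The total derivative in direction `i` of the coordinates of the base point. -/
def tangent (j : Jet) (i : Fin 3) : Space := (Pi.single i 1, fun a => j.2 a (raise 0 i))

/-- Second total derivatives of the coordinates of the base point. -/
def tangent₂ (j : Jet) (k i : Fin 3) : Space := (0, fun a => j.2 a (raise (raise 0 k) i))

/-- Third total derivatives of the coordinates of the base point. -/
def tangent₃ (j : Jet) (l k i : Fin 3) : Space :=
  (0, fun a => j.2 a (raise (raise (raise 0 l) k) i))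

/-- This reduces total derivatives of functions on the base to ordinary Fréchet derivatives on the
finite-dimensional `Space`, where the chain rule applies. -/
theorem base_add_smul_shift (i : Fin 3) (j : Jet) (s : ℝ) :
    (j + s • shift i j).base = j.base + s • tangent j i := rfl

theorem hasDerivAt_line {E : Type*} [NormedAddCommGroup E] [NormedSpace ℝ E] (x v : E) :
    HasDerivAt (fun s : ℝ => x + s • v) v 0 := by
  simpa using ((hasDerivAt_id (0 : ℝ)).smul_const v).const_add x

theorem hasDerivAt_comp_base {E : Type*} [NormedAddCommGroup E] [NormedSpace ℝ E]
    {A : Space → E} (hA : Differentiable ℝ A) (i : Fin 3) (j : Jet) :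
    HasDerivAt (fun s : ℝ => A (j + s • shift i j).base) (fderiv ℝ A j.base (tangent j i)) 0 := by
  have h := (hA (j.base + (0 : ℝ) • tangent j i)).hasFDerivAt.comp_hasDerivAt (0 : ℝ)
    (hasDerivAt_line j.base (tangent j i))
  simpa [Function.comp_def, base_add_smul_shift] using h

theorem hasDerivAt_tangent (i k : Fin 3) (j : Jet) :
    HasDerivAt (fun s : ℝ => tangent (j + s • shift i j) k) (tangent₂ j k i) 0 := by
  have h := hasDerivAt_line (tangent j k) (tangent₂ j k i)
  refine h.congr_of_eventuallyEq (Filter.Eventually.of_forall fun s => ?_)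
  simp [tangent, tangent₂, shift]
  rfl

theorem hasDerivAt_tangent₂ (i k l : Fin 3) (j : Jet) :
    HasDerivAt (fun s : ℝ => tangent₂ (j + s • shift i j) l k) (tangent₃ j l k i) 0 := by
  have h := hasDerivAt_line (tangent₂ j l k) (tangent₃ j l k i)
  refine h.congr_of_eventuallyEq (Filter.Eventually.of_forall fun s => ?_)
  simp [tangent₃, tangent₂, shift]
  rfl

/-- `D_k A` for a function `A` on the base. -/
def jetD₁ (A : Space → ℝ) (k : Fin 3) (j : Jet) : ℝ := fderiv ℝ A j.base (tangent j k)

/-- `D_i D_k A` for a function `A` on the base. -/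
def jetD₂ (A : Space → ℝ) (i k : Fin 3) (j : Jet) : ℝ :=
  fderiv ℝ (fderiv ℝ A) j.base (tangent j i) (tangent j k) + fderiv ℝ A j.base (tangent₂ j k i)

/-- `D_i D_k D_l A` for a function `A` on the base. -/
def jetD₃ (A : Space → ℝ) (i k l : Fin 3) (j : Jet) : ℝ :=
  fderiv ℝ (fderiv ℝ (fderiv ℝ A)) j.base (tangent j i) (tangent j k) (tangent j l)
    + fderiv ℝ (fderiv ℝ A) j.base (tangent₂ j k i) (tangent j l)
    + fderiv ℝ (fderiv ℝ A) j.base (tangent j k) (tangent₂ j l i)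
    + (fderiv ℝ (fderiv ℝ A) j.base (tangent j i) (tangent₂ j l k)
      + fderiv ℝ A j.base (tangent₃ j l k i))

theorem smooth_fderiv {E : Type*} [NormedAddCommGroup E] [NormedSpace ℝ E] {A : Space → E}
    (hA : ContDiff ℝ ∞ A) : ContDiff ℝ ∞ (fderiv ℝ A) :=
  hA.fderiv_right (by simp)

theorem smooth_differentiable {E : Type*} [NormedAddCommGroup E] [NormedSpace ℝ E] {A : Space → E}
    (hA : ContDiff ℝ ∞ A) : Differentiable ℝ A :=
  hA.differentiable (by simp)

theorem isTotalDeriv_base {A : Space → ℝ} (hA : ContDiff ℝ ∞ A) (i : Fin 3) :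
    IsTotalDeriv i (fun j => A j.base) (jetD₁ A i) :=
  fun j => hasDerivAt_comp_base (smooth_differentiable hA) i j

theorem shift_zero_line (i : Fin 3) (j : Jet) : j + (0 : ℝ) • shift i j = j := by simp

theorem isTotalDeriv_jetD₁ {A : Space → ℝ} (hA : ContDiff ℝ ∞ A) (i k : Fin 3) :
    IsTotalDeriv i (jetD₁ A k) (jetD₂ A i k) := fun j => by
  have h := (hasDerivAt_comp_base (smooth_differentiable (smooth_fderiv hA)) i j).clm_apply
    (hasDerivAt_tangent i k j)
  simp only [shift_zero_line] at h
  exact h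

theorem isTotalDeriv_jetD₂ {A : Space → ℝ} (hA : ContDiff ℝ ∞ A) (i k l : Fin 3) :
    IsTotalDeriv i (jetD₂ A k l) (jetD₃ A i k l) := fun j => by
  have h := (((hasDerivAt_comp_base (smooth_differentiable (smooth_fderiv (smooth_fderiv hA)))
    i j).clm_apply (hasDerivAt_tangent i k j)).clm_apply (hasDerivAt_tangent i l j)).add
    ((hasDerivAt_comp_base (smooth_differentiable (smooth_fderiv hA)) i j).clm_apply
    (hasDerivAt_tangent₂ i k l j))
  simp only [shift_zero_line, add_apply] at h
  exact h

/-! ### Total derivatives of the characteristic -/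

/-- The coefficient `ξ^l` of a vector field. -/
def xi (v : VField) (l : Fin 3) (p : Space) : ℝ := (v.1 p).1 l

/-- The coefficient `η^a` of a vector field. -/
def eta (v : VField) (a : Fin 2) (p : Space) : ℝ := (v.1 p).2 a

theorem contDiff_xi (v : VField) (l : Fin 3) : ContDiff ℝ ∞ (xi v l) :=
  (contDiff_pi.1 v.contDiff.fst) l

theorem contDiff_eta (v : VField) (a : Fin 2) : ContDiff ℝ ∞ (eta v a) :=
  (contDiff_pi.1 v.contDiff.snd) a

/-- `D_i` of the characteristic. -/
def charD₁ (v : VField) (a : Fin 2) (i : Fin 3) (j : Jet) : ℝ :=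
  jetD₁ (eta v a) i j - ∑ m, (jetD₁ (xi v m) i j * j.2 a (raise 0 m)
    + xi v m j.base * j.2 a (raise (raise 0 m) i))

/-- `D_i D_k` of the characteristic. -/
def charD₂ (v : VField) (a : Fin 2) (i k : Fin 3) (j : Jet) : ℝ :=
  jetD₂ (eta v a) i k j - ∑ m, ((jetD₂ (xi v m) i k j * j.2 a (raise 0 m)
    + jetD₁ (xi v m) k j * j.2 a (raise (raise 0 m) i))
    + (jetD₁ (xi v m) i j * j.2 a (raise (raise 0 m) k)
    + xi v m j.base * j.2 a (raise (raise (raise 0 m) k) i)))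

/-- `D_i D_k D_l` of the characteristic. -/
def charD₃ (v : VField) (a : Fin 2) (i k l : Fin 3) (j : Jet) : ℝ :=
  jetD₃ (eta v a) i k l j - ∑ m, (
    ((jetD₃ (xi v m) i k l j * j.2 a (raise 0 m)
      + jetD₂ (xi v m) k l j * j.2 a (raise (raise 0 m) i))
    + (jetD₂ (xi v m) i l j * j.2 a (raise (raise 0 m) k)
      + jetD₁ (xi v m) l j * j.2 a (raise (raise (raise 0 m) k) i)))
    + ((jetD₂ (xi v m) i k j * j.2 a (raise (raise 0 m) l)
      + jetD₁ (xi v m) k j * j.2 a (raise (raise (raise 0 m) l) i))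
    + (jetD₁ (xi v m) i j * j.2 a (raise (raise (raise 0 m) l) k)
      + xi v m j.base * j.2 a (raise (raise (raise (raise 0 m) l) k) i))))

theorem isTotalDeriv_characteristic (v : VField) (a : Fin 2) (i : Fin 3) :
    IsTotalDeriv i (characteristic v a) (charD₁ v a i) :=
  (isTotalDeriv_base (contDiff_eta v a) i).sub (IsTotalDeriv.sum fun m _ =>
    (isTotalDeriv_base (contDiff_xi v m) i).mul (isTotalDeriv_coord i a _))

theorem isTotalDeriv_charD₁ (v : VField) (a : Fin 2) (i k : Fin 3) :
    IsTotalDeriv i (charD₁ v a k) (charD₂ v a i k) :=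
  (isTotalDeriv_jetD₁ (contDiff_eta v a) i k).sub (IsTotalDeriv.sum fun m _ =>
    ((isTotalDeriv_jetD₁ (contDiff_xi v m) i k).mul (isTotalDeriv_coord i a _)).add
    ((isTotalDeriv_base (contDiff_xi v m) i).mul (isTotalDeriv_coord i a _)))

theorem isTotalDeriv_charD₂ (v : VField) (a : Fin 2) (i k l : Fin 3) :
    IsTotalDeriv i (charD₂ v a k l) (charD₃ v a i k l) :=
  (isTotalDeriv_jetD₂ (contDiff_eta v a) i k l).sub (IsTotalDeriv.sum fun m _ =>
    (((isTotalDeriv_jetD₂ (contDiff_xi v m) i k l).mul (isTotalDeriv_coord i a _)).add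
      ((isTotalDeriv_jetD₁ (contDiff_xi v m) i l).mul (isTotalDeriv_coord i a _))).add
    (((isTotalDeriv_jetD₁ (contDiff_xi v m) i k).mul (isTotalDeriv_coord i a _)).add
      ((isTotalDeriv_base (contDiff_xi v m) i).mul (isTotalDeriv_coord i a _))))

theorem totalDerivMulti_txx (P : Jet → ℝ) : totalDerivMulti ![1, 2, 0] P =
    totalDeriv 0 (totalDeriv 1 (totalDeriv 1 P)) := rfl

theorem totalDerivMulti_tyy (P : Jet → ℝ) : totalDerivMulti ![1, 0, 2] P =
    totalDeriv 0 (totalDeriv 2 (totalDeriv 2 P)) := rfl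

theorem totalDerivMulti_xxx (P : Jet → ℝ) : totalDerivMulti ![0, 3, 0] P =
    totalDeriv 1 (totalDeriv 1 (totalDeriv 1 P)) := rfl

theorem totalDerivMulti_xyy (P : Jet → ℝ) : totalDerivMulti ![0, 1, 2] P =
    totalDeriv 1 (totalDeriv 2 (totalDeriv 2 P)) := rfl

theorem totalDerivMulti_xxy (P : Jet → ℝ) : totalDerivMulti ![0, 2, 1] P =
    totalDeriv 1 (totalDeriv 1 (totalDeriv 2 P)) := rfl

theorem totalDerivMulti_yyy (P : Jet → ℝ) : totalDerivMulti ![0, 0, 3] P =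
    totalDeriv 2 (totalDeriv 2 (totalDeriv 2 P)) := rfl

theorem totalDeriv_characteristic (v : VField) (a : Fin 2) (i : Fin 3) :
    totalDeriv i (characteristic v a) = charD₁ v a i :=
  (isTotalDeriv_characteristic v a i).eq

theorem totalDeriv_totalDeriv_totalDeriv_characteristic (v : VField) (a : Fin 2) (i k l : Fin 3) :
    totalDeriv i (totalDeriv k (totalDeriv l (characteristic v a))) = charD₃ v a i k l := by
  rw [(isTotalDeriv_characteristic v a l).eq, (isTotalDeriv_charD₁ v a k l).eq,
    (isTotalDeriv_charD₂ v a i k l).eq]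

/-- The components of the prolongation of `v` that enter the invariance criterion. -/
theorem prolongation_snd (v : VField) (j : Jet) (a : Fin 2) (J : Fin 3 → ℕ) {w : Jet → ℝ}
    (h : totalDerivMulti J (characteristic v a) = w) :
    (prolongation v j).2 a J = w j + ∑ m, xi v m j.base * j.2 a (raise J m) := by
  rw [← h]
  rfl

/-! ### The system and its linearization -/

theorem raise_zero (l m n : ℕ) : raise ![l, m, n] 0 = ![l + 1, m, n] := by
  ext i; fin_cases i <;> simp [raise]

theorem raise_one (l m n : ℕ) : raise ![l, m, n] 1 = ![l, m + 1, n] := by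
  ext i; fin_cases i <;> simp [raise]

theorem raise_two (l m n : ℕ) : raise ![l, m, n] 2 = ![l, m, n + 1] := by
  ext i; fin_cases i <;> simp [raise]

theorem multiIndex_zero : (0 : Fin 3 → ℕ) = ![0, 0, 0] := by
  ext i; fin_cases i <;> rfl

theorem potentialVorticity_eq (F β : ℝ) {a b : Fin 2} (hab : a ≠ b) (j : Jet) :
    potentialVorticity F β a j = j.2 a ![0, 2, 0] + j.2 a ![0, 0, 2] + β * j.1 2
      - F * (j.2 a ![0, 0, 0] - j.2 b ![0, 0, 0]) := by
  fin_cases a <;> fin_cases b <;> simp [potentialVorticity, multiIndex_zero] at hab ⊢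
  · ring
  · ring

theorem isTotalDeriv_potentialVorticity (F β : ℝ) {a b : Fin 2} (hab : a ≠ b) (i : Fin 3) :
    IsTotalDeriv i (potentialVorticity F β a) (fun j =>
      j.2 a (raise ![0, 2, 0] i) + j.2 a (raise ![0, 0, 2] i)
      + β * (Pi.single i 1 : Fin 3 → ℝ) 2
      - F * (j.2 a (raise ![0, 0, 0] i) - j.2 b (raise ![0, 0, 0] i))) := by
  rw [funext (potentialVorticity_eq F β hab)]
  exact (((isTotalDeriv_coord i a _).add (isTotalDeriv_coord i a _)).add
    ((isTotalDeriv_indep i 2).const_mul β)).sub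
    (((isTotalDeriv_coord i a _).sub (isTotalDeriv_coord i b _)).const_mul F)

theorem system_eq (F β : ℝ) {a b : Fin 2} (hab : a ≠ b) (j : Jet) :
    system F β a j =
      (j.2 a ![1, 2, 0] + j.2 a ![1, 0, 2] - F * (j.2 a ![1, 0, 0] - j.2 b ![1, 0, 0]))
      + (j.2 a ![0, 1, 0] * (j.2 a ![0, 2, 1] + j.2 a ![0, 0, 3] + β
          - F * (j.2 a ![0, 0, 1] - j.2 b ![0, 0, 1]))
        - j.2 a ![0, 0, 1] * (j.2 a ![0, 3, 0] + j.2 a ![0, 1, 2]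
          - F * (j.2 a ![0, 1, 0] - j.2 b ![0, 1, 0]))) := by
  simp only [system, (isTotalDeriv_potentialVorticity F β hab _).eq, raise_zero, raise_one,
    raise_two]
  simp

/-- The linearization of the system at `j` in the direction `d`. -/
theorem lineDeriv_system (F β : ℝ) {a b : Fin 2} (hab : a ≠ b) (j d : Jet) :
    lineDeriv ℝ (system F β a) j d =
      (d.2 a ![1, 2, 0] + d.2 a ![1, 0, 2] - F * (d.2 a ![1, 0, 0] - d.2 b ![1, 0, 0]))
      + (d.2 a ![0, 1, 0] * (j.2 a ![0, 2, 1] + j.2 a ![0, 0, 3] + β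
          - F * (j.2 a ![0, 0, 1] - j.2 b ![0, 0, 1]))
        + j.2 a ![0, 1, 0] * (d.2 a ![0, 2, 1] + d.2 a ![0, 0, 3]
          - F * (d.2 a ![0, 0, 1] - d.2 b ![0, 0, 1]))
        - (d.2 a ![0, 0, 1] * (j.2 a ![0, 3, 0] + j.2 a ![0, 1, 2]
          - F * (j.2 a ![0, 1, 0] - j.2 b ![0, 1, 0]))
          + j.2 a ![0, 0, 1] * (d.2 a ![0, 3, 0] + d.2 a ![0, 1, 2]
          - F * (d.2 a ![0, 1, 0] - d.2 b ![0, 1, 0])))) := by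
  rw [funext (system_eq F β hab)]
  have c (e : Fin 2) (J : Fin 3 → ℕ) :
      HasDerivAt (fun s : ℝ => (j + s • d).2 e J) (d.2 e J) 0 := hasLineDerivAt_coord e J j d
  have h := (((c a ![1, 2, 0]).fun_add (c a ![1, 0, 2])).fun_sub
      (((c a ![1, 0, 0]).fun_sub (c b ![1, 0, 0])).const_mul F)).fun_add
    (((c a ![0, 1, 0]).fun_mul ((((c a ![0, 2, 1]).fun_add (c a ![0, 0, 3])).add_const β).fun_sub
      (((c a ![0, 0, 1]).fun_sub (c b ![0, 0, 1])).const_mul F))).fun_sub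
    ((c a ![0, 0, 1]).fun_mul (((c a ![0, 3, 0]).fun_add (c a ![0, 1, 2])).fun_sub
      (((c a ![0, 1, 0]).fun_sub (c b ![0, 1, 0])).const_mul F))))
  refine (HasDerivAt.deriv h).trans ?_
  simp

/-! ### The generators are Lie symmetries -/

theorem raise_comm (J : Fin 3 → ℕ) (i k : Fin 3) : raise (raise J i) k = raise (raise J k) i := by
  simp only [raise]; abel

/-- The vector field `a ∂_t + b ∂_y + c 𝓕 + 𝓧(f) + 𝓩(g)`. -/
def normalForm (c : ℝ × ℝ × ℝ × smoothFunctions × smoothFunctions) : VField :=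
  c.1 • fieldT + c.2.1 • fieldY + c.2.2.1 • fieldF + fieldX c.2.2.2.1 + fieldZ c.2.2.2.2

theorem normalForm_apply (c : ℝ × ℝ × ℝ × smoothFunctions × smoothFunctions) (p : Space) :
    (normalForm c).1 p = (![c.1, c.2.2.2.1.1 (p.1 0), c.2.1],
      ![c.2.2.1 - deriv c.2.2.2.1.1 (p.1 0) * p.1 2 + c.2.2.2.2.1 (p.1 0),
        -c.2.2.1 - deriv c.2.2.2.1.1 (p.1 0) * p.1 2 + c.2.2.2.2.1 (p.1 0)]) := by
  refine Prod.ext (funext fun i => ?_) (funext fun i => ?_)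
  · fin_cases i <;> simp [normalForm, fieldT, fieldY, fieldF, fieldX, fieldZ]
  · fin_cases i <;> simp [normalForm, fieldT, fieldY, fieldF, fieldX, fieldZ] <;> ring

theorem contDiff_smoothFunction (f : smoothFunctions) : ContDiff ℝ ∞ f.1 :=
  mem_smoothFunctions.1 f.2

theorem differentiable_smoothFunction (f : smoothFunctions) : Differentiable ℝ f.1 :=
  (contDiff_smoothFunction f).differentiable (by simp)

/-- The derivative of a smooth function. -/
def smoothDeriv (f : smoothFunctions) : smoothFunctions :=
  ⟨deriv f.1, mem_smoothFunctions.2 (contDiff_infty_iff_deriv.1 (contDiff_smoothFunction f)).2⟩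

theorem isTotalDeriv_time (f : smoothFunctions) (i : Fin 3) :
    IsTotalDeriv i (fun j => f.1 (j.1 0))
      (fun j => (Pi.single i 1 : Fin 3 → ℝ) 0 * deriv f.1 (j.1 0)) := fun j => by
  have h := HasDerivAt.comp (0 : ℝ) (differentiable_smoothFunction f ((j + (0 : ℝ) • shift i j).1 0)).hasDerivAt
    (isTotalDeriv_indep i 0 j)
  simp only [shift_zero_line] at h
  rw [mul_comm] at h
  exact h

/-- The part `∑ᵢ ξⁱ ψᵃ_{J,i}` for `ξ = (τ, f(t), κ)`. -/
def transport (τ κ : ℝ) (f : smoothFunctions) (a : Fin 2) (J : Fin 3 → ℕ) (j : Jet) : ℝ :=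
  τ * j.2 a (raise J 0) + f.1 (j.1 0) * j.2 a (raise J 1) + κ * j.2 a (raise J 2)

theorem isTotalDeriv_transport (τ κ : ℝ) (f : smoothFunctions) (a : Fin 2) (J : Fin 3 → ℕ)
    (i : Fin 3) :
    IsTotalDeriv i (transport τ κ f a J) (fun j => transport τ κ f a (raise J i) j
      + (Pi.single i 1 : Fin 3 → ℝ) 0 * deriv f.1 (j.1 0) * j.2 a (raise J 1)) := by
  refine ((((isTotalDeriv_coord i a (raise J 0)).const_mul τ).add
    ((isTotalDeriv_time f i).mul (isTotalDeriv_coord i a (raise J 1)))).add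
    ((isTotalDeriv_coord i a (raise J 2)).const_mul κ)).congr fun j => ?_
  simp only [transport, raise_comm J i]
  ring

/-- The prolongation of a field with characteristic
`γ(t) - f'(t) y - τ ψ_t - f(t) ψ_x - κ ψ_y`. -/
theorem totalDerivMulti_of_transport {τ κ : ℝ} {f γ : smoothFunctions} {a : Fin 2} {P : Jet → ℝ}
    (hP : P = fun j => γ.1 (j.1 0) - deriv f.1 (j.1 0) * j.1 2 - transport τ κ f a ![0, 0, 0] j) :
    totalDerivMulti ![1, 0, 0] P = (fun j => deriv γ.1 (j.1 0) - deriv (deriv f.1) (j.1 0) * j.1 2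
      - deriv f.1 (j.1 0) * j.2 a ![0, 1, 0] - transport τ κ f a ![1, 0, 0] j) ∧
    totalDerivMulti ![0, 1, 0] P = (fun j => - transport τ κ f a ![0, 1, 0] j) ∧
    totalDerivMulti ![0, 0, 1] P = (fun j => - deriv f.1 (j.1 0)
      - transport τ κ f a ![0, 0, 1] j) ∧
    totalDerivMulti ![1, 2, 0] P = (fun j => - deriv f.1 (j.1 0) * j.2 a ![0, 3, 0]
      - transport τ κ f a ![1, 2, 0] j) ∧
    totalDerivMulti ![1, 0, 2] P = (fun j => - deriv f.1 (j.1 0) * j.2 a ![0, 1, 2]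
      - transport τ κ f a ![1, 0, 2] j) ∧
    totalDerivMulti ![0, 3, 0] P = (fun j => - transport τ κ f a ![0, 3, 0] j) ∧
    totalDerivMulti ![0, 1, 2] P = (fun j => - transport τ κ f a ![0, 1, 2] j) ∧
    totalDerivMulti ![0, 2, 1] P = (fun j => - transport τ κ f a ![0, 2, 1] j) ∧
    totalDerivMulti ![0, 0, 3] P = (fun j => - transport τ κ f a ![0, 0, 3] j) := by
  have hT := isTotalDeriv_transport τ κ f a
  have hf := isTotalDeriv_time (smoothDeriv f)
  have h (i : Fin 3) : IsTotalDeriv i P _ := hP ▸ ((isTotalDeriv_time γ i).sub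
    ((hf i).mul (isTotalDeriv_indep i 2))).sub (hT ![0, 0, 0] i)
  have h0 := (h 0).congr (Q := fun j => deriv γ.1 (j.1 0) - deriv (deriv f.1) (j.1 0) * j.1 2
      - deriv f.1 (j.1 0) * j.2 a ![0, 1, 0] - transport τ κ f a ![1, 0, 0] j) fun j => by
    simp [raise_zero, raise_one, smoothDeriv]; ring
  have h1 := (h 1).congr (Q := fun j => (0 : ℝ) - transport τ κ f a ![0, 1, 0] j) fun j => by
    simp [raise_one, smoothDeriv]
  have h2 := (h 2).congr (Q := fun j => 0 - deriv f.1 (j.1 0)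
      - transport τ κ f a ![0, 0, 1] j) fun j => by
    simp [raise_one, raise_two, smoothDeriv]
  have hneg (J : Fin 3 → ℕ) (i : Fin 3) := (isTotalDeriv_const i 0).sub (hT J i)
  -- Since `f` depends on `t` only, `D_x` and `D_y` merely raise the multi-index of the transport
  -- term; `D_t` also produces `f' ψᵃ_{J,x}`.
  have hx (l m n : ℕ) : IsTotalDeriv 1 (fun j => (0 : ℝ) - transport τ κ f a ![l, m, n] j)
      (fun j => (0 : ℝ) - transport τ κ f a ![l, m + 1, n] j) :=
    (hneg _ 1).congr fun j => by simp [raise_one]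
  have hy (l m n : ℕ) : IsTotalDeriv 2 (fun j => (0 : ℝ) - transport τ κ f a ![l, m, n] j)
      (fun j => (0 : ℝ) - transport τ κ f a ![l, m, n + 1] j) :=
    (hneg _ 2).congr fun j => by simp [raise_two]
  have ht (l m n : ℕ) : IsTotalDeriv 0 (fun j => (0 : ℝ) - transport τ κ f a ![l, m, n] j)
      (fun j => - deriv f.1 (j.1 0) * j.2 a ![l, m + 1, n]
        - transport τ κ f a ![l + 1, m, n] j) :=
    (hneg _ 0).congr fun j => by simp [raise_zero, raise_one]; ring
  have hxy : IsTotalDeriv 1 (fun j => 0 - deriv f.1 (j.1 0) - transport τ κ f a ![0, 0, 1] j)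
      (fun j => (0 : ℝ) - transport τ κ f a ![0, 1, 1] j) :=
    (((isTotalDeriv_const 1 0).sub (hf 1)).sub (hT _ 1)).congr fun j => by simp [raise_one]
  have hyy : IsTotalDeriv 2 (fun j => 0 - deriv f.1 (j.1 0) - transport τ κ f a ![0, 0, 1] j)
      (fun j => (0 : ℝ) - transport τ κ f a ![0, 0, 2] j) :=
    (((isTotalDeriv_const 2 0).sub (hf 2)).sub (hT _ 2)).congr fun j => by simp [raise_two]
  refine ⟨h0.eq, ?_, ?_, ?_, ?_, ?_, ?_, ?_, ?_⟩
  · exact h1.eq.trans (by simp)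
  · exact h2.eq.trans (by simp)
  · rw [totalDerivMulti_txx, h1.eq, (hx _ _ _).eq, (ht _ _ _).eq]
  · rw [totalDerivMulti_tyy, h2.eq, hyy.eq, (ht _ _ _).eq]
  · rw [totalDerivMulti_xxx, h1.eq, (hx _ _ _).eq, (hx _ _ _).eq]; simp
  · rw [totalDerivMulti_xyy, h2.eq, hyy.eq, (hx _ _ _).eq]; simp
  · rw [totalDerivMulti_xxy, h2.eq, hxy.eq, (hx _ _ _).eq]; simp
  · rw [totalDerivMulti_yyy, h2.eq, hyy.eq, (hy _ _ _).eq]; simp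

/-- The transport terms cancel against `∑ᵢ ξⁱ ψᵃ_{J,i}`. Among the components that enter the system
there remain only `g' - f'' y - f' ψᵃ_x` along `ψᵃ_t`, `-f'` along `ψᵃ_y`, and `-f' ψᵃ_xxx`, `-f'
ψᵃ_xyy` along `ψᵃ_txx`, `ψᵃ_tyy`. This is a Galilean boost in `x`: the change of `Qᵃ_t` is
compensated by that of `ψᵃ_y Qᵃ_x`. -/
theorem isLieSymmetry_normalForm (F β : ℝ)
    (c : ℝ × ℝ × ℝ × smoothFunctions × smoothFunctions) :
    IsLieSymmetry F β (normalForm c) := by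
  obtain ⟨τ, κ, ε, f, g⟩ := c
  intro j hj a
  let γ (a : Fin 2) : smoothFunctions :=
    g + ⟨fun _ => (![ε, -ε] : Fin 2 → ℝ) a, mem_smoothFunctions.2 contDiff_const⟩
  have hγ (a : Fin 2) : deriv (γ a).1 = deriv g.1 := by
    funext t
    exact deriv_add_const _
  have hchar (a : Fin 2) : characteristic (normalForm (τ, κ, ε, f, g)) a = fun j =>
      (γ a).1 (j.1 0) - deriv f.1 (j.1 0) * j.1 2 - transport τ κ f a ![0, 0, 0] j := by
    funext j
    fin_cases a <;>
      simp [characteristic, normalForm_apply, γ, transport, Fin.sum_univ_three, Jet.base,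
        multiIndex_zero] <;> ring
  have hsum (a : Fin 2) (J : Fin 3 → ℕ) :
      ∑ m, xi (normalForm (τ, κ, ε, f, g)) m j.base * j.2 a (raise J m)
        = transport τ κ f a J j := by
    simp [xi, normalForm_apply, transport, Fin.sum_univ_three, Jet.base]
  obtain ⟨b, hab⟩ : ∃ b, a ≠ b := ⟨1 - a, by fin_cases a <;> decide⟩
  obtain ⟨a1, a2, a3, a4, a5, a6, a7, a8, a9⟩ := totalDerivMulti_of_transport (hchar a)
  obtain ⟨b1, b2, b3, -⟩ := totalDerivMulti_of_transport (hchar b)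
  rw [lineDeriv_system F β hab]
  simp only [prolongation_snd _ j _ _ a1, prolongation_snd _ j _ _ a2, prolongation_snd _ j _ _ a3,
    prolongation_snd _ j _ _ a4, prolongation_snd _ j _ _ a5, prolongation_snd _ j _ _ a6,
    prolongation_snd _ j _ _ a7, prolongation_snd _ j _ _ a8, prolongation_snd _ j _ _ a9,
    prolongation_snd _ j _ _ b1, prolongation_snd _ j _ _ b2, prolongation_snd _ j _ _ b3, hsum, hγ]
  ring

/-! ### Partial derivatives on the base -/

/-- The derivative of `A` in the constant direction `w`. -/
def pd (w : Space) (A : Space → ℝ) (p : Space) : ℝ := fderiv ℝ A p w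

theorem contDiff_pd {A : Space → ℝ} (hA : ContDiff ℝ ∞ A) (w : Space) : ContDiff ℝ ∞ (pd w A) :=
  (smooth_fderiv hA).clm_apply contDiff_const

theorem pd_pd {A : Space → ℝ} (hA : ContDiff ℝ ∞ A) (u w p : Space) :
    pd u (pd w A) p = fderiv ℝ (fderiv ℝ A) p u w := by
  have h := (smooth_differentiable (smooth_fderiv hA) p).hasFDerivAt.clm_apply
    (hasFDerivAt_const w p)
  have h' : fderiv ℝ (pd w A) p = _ := h.fderiv
  simp [pd, h']

theorem pd_pd_pd {A : Space → ℝ} (hA : ContDiff ℝ ∞ A) (u v w p : Space) :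
    pd u (pd v (pd w A)) p = fderiv ℝ (fderiv ℝ (fderiv ℝ A)) p u v w := by
  have h := ((smooth_differentiable (smooth_fderiv (smooth_fderiv hA)) p).hasFDerivAt.clm_apply
    (hasFDerivAt_const v p)).clm_apply (hasFDerivAt_const w p)
  rw [funext (pd_pd hA v w)]
  change fderiv ℝ _ p u = _
  rw [h.fderiv]
  simp

theorem pd_comm {A : Space → ℝ} (hA : ContDiff ℝ ∞ A) (u w : Space) :
    pd u (pd w A) = pd w (pd u A) := by
  funext p
  rw [pd_pd hA, pd_pd hA]
  have h : IsSymmSndFDerivAt ℝ A p := hA.contDiffAt.isSymmSndFDerivAt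
    (by simpa using WithTop.coe_le_coe.2 (le_top : (2 : ℕ∞) ≤ ⊤))
  exact h u w

theorem pd_add_dir (u w : Space) (A : Space → ℝ) (p : Space) :
    pd (u + w) A p = pd u A p + pd w A p := map_add _ _ _

theorem pd_smul_dir (c : ℝ) (w : Space) (A : Space → ℝ) (p : Space) :
    pd (c • w) A p = c * pd w A p := map_smul _ _ _

/-- The coordinate directions `∂_t`, `∂_x`, `∂_y`. -/
def dz (i : Fin 3) : Space := (Pi.single i 1, 0)

/-- The coordinate directions `∂_{ψ¹}`, `∂_{ψ²}`. -/
def dψ (a : Fin 2) : Space := (0, Pi.single a 1)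

theorem vertical_eq {a b : Fin 2} (hab : a ≠ b) (w : Fin 2 → ℝ) :
    ((0, w) : Space) = w a • dψ a + w b • dψ b := by
  refine Prod.ext (by simp [dψ]) (funext fun d => ?_)
  fin_cases a <;> fin_cases b <;> fin_cases d <;> simp [dψ] at hab ⊢

theorem direction_eq {a b : Fin 2} (hab : a ≠ b) (i : Fin 3) (w : Fin 2 → ℝ) :
    ((Pi.single i 1, w) : Space) = dz i + (w a • dψ a + w b • dψ b) := by
  rw [← vertical_eq hab]
  simp [dz]

theorem pd_vertical {a b : Fin 2} (hab : a ≠ b) (w : Fin 2 → ℝ) (A : Space → ℝ) (p : Space) :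
    pd (0, w) A p = w a * pd (dψ a) A p + w b * pd (dψ b) A p := by
  rw [vertical_eq hab, pd_add_dir, pd_smul_dir, pd_smul_dir]

theorem pd_direction {a b : Fin 2} (hab : a ≠ b) (i : Fin 3) (w : Fin 2 → ℝ) (A : Space → ℝ)
    (p : Space) :
    pd (Pi.single i 1, w) A p
      = pd (dz i) A p + (w a * pd (dψ a) A p + w b * pd (dψ b) A p) := by
  rw [direction_eq hab, pd_add_dir, pd_add_dir, pd_smul_dir, pd_smul_dir]

/-! ### Jets with vanishing coordinates of order two and four -/

/-- The order of the derivative with multi-index `J`. -/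
def order (J : Fin 3 → ℕ) : ℕ := J 0 + J 1 + J 2

theorem order_zero : order 0 = 0 := rfl

theorem order_vec (l m n : ℕ) : order ![l, m, n] = l + m + n := rfl

theorem order_raise (J : Fin 3 → ℕ) (i : Fin 3) : order (raise J i) = order J + 1 := by
  fin_cases i <;> simp [raise, order] <;> ring

/-- The jet over the point `X` with the first order coordinates `p` and the third order
coordinates `q`, whose other coordinates vanish. -/
def testJet (X : Space) (p : Fin 2 → Fin 3 → ℝ) (q : Fin 2 → ℕ → ℕ → ℕ → ℝ) : Jet :=
  (X.1, fun a J => if order J = 0 then X.2 a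
    else if order J = 1 then J 0 * p a 0 + J 1 * p a 1 + J 2 * p a 2
    else if order J = 3 then q a (J 0) (J 1) (J 2) else 0)

/-- The coordinate of order three in the directions `i`, `k`, `l`. -/
def third (q : ℕ → ℕ → ℕ → ℝ) (i k l : Fin 3) : ℝ :=
  q (raise (raise (raise 0 i) k) l 0) (raise (raise (raise 0 i) k) l 1)
    (raise (raise (raise 0 i) k) l 2)

section testJet

variable (X : Space) (p : Fin 2 → Fin 3 → ℝ) (q : Fin 2 → ℕ → ℕ → ℕ → ℝ)

theorem testJet_base : (testJet X p q).base = X := by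
  simp [testJet, Jet.base, order_zero]

theorem testJet_one (a : Fin 2) (i : Fin 3) : (testJet X p q).2 a (raise 0 i) = p a i := by
  fin_cases i <;> simp [testJet, order_raise, order_zero] <;> simp [raise]

theorem testJet_two (a : Fin 2) (i k : Fin 3) :
    (testJet X p q).2 a (raise (raise 0 i) k) = 0 := by
  simp [testJet, order_raise, order_zero]

theorem testJet_three (a : Fin 2) (i k l : Fin 3) :
    (testJet X p q).2 a (raise (raise (raise 0 i) k) l) = third (q a) i k l := by
  simp [testJet, order_raise, order_zero, third]

theorem testJet_four (a : Fin 2) (i k l m : Fin 3) :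
    (testJet X p q).2 a (raise (raise (raise (raise 0 i) k) l) m) = 0 := by
  simp [testJet, order_raise, order_zero]

/-- The total derivative in direction `i` of the coordinates, at a test jet. -/
def dir (p : Fin 2 → Fin 3 → ℝ) (i : Fin 3) : Space := (Pi.single i 1, fun a => p a i)

theorem testJet_tangent (i : Fin 3) : tangent (testJet X p q) i = dir p i := by
  simp only [tangent, testJet_one, dir]

theorem testJet_tangent₂ (k i : Fin 3) : tangent₂ (testJet X p q) k i = 0 := by
  simp only [tangent₂, testJet_two]
  rfl

theorem testJet_tangent₃ (l k i : Fin 3) :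
    tangent₃ (testJet X p q) l k i = (0, fun a => third (q a) l k i) := by
  simp only [tangent₃, testJet_three]

/-- The first order component of the prolongation at a test jet. -/
def testD₁ (v : VField) (X : Space) (p : Fin 2 → Fin 3 → ℝ) (a : Fin 2) (i : Fin 3) : ℝ :=
  pd (dir p i) (eta v a) X - ∑ m, pd (dir p i) (xi v m) X * p a m

/-- The part of the third order component of the prolongation at a test jet that does not
depend on the third order coordinates. -/
def testLow (v : VField) (X : Space) (p : Fin 2 → Fin 3 → ℝ) (a : Fin 2) (i k l : Fin 3) : ℝ :=
  pd (dir p i) (pd (dir p k) (pd (dir p l) (eta v a))) X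
    - ∑ m, pd (dir p i) (pd (dir p k) (pd (dir p l) (xi v m))) X * p a m

/-- The part of the third order component of the prolongation at a test jet that is linear
in the third order coordinates. -/
def testTop (v : VField) (X : Space) (p : Fin 2 → Fin 3 → ℝ) (q : Fin 2 → ℕ → ℕ → ℕ → ℝ)
    (a b : Fin 2) (i k l : Fin 3) : ℝ :=
  third (q a) l k i * (pd (dψ a) (eta v a) X - ∑ m, pd (dψ a) (xi v m) X * p a m)
    + third (q b) l k i * (pd (dψ b) (eta v a) X - ∑ m, pd (dψ b) (xi v m) X * p a m)
    - ∑ m, (pd (dir p l) (xi v m) X * third (q a) m k i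
      + pd (dir p k) (xi v m) X * third (q a) m l i
      + pd (dir p i) (xi v m) X * third (q a) m l k)

theorem jetD₁_testJet (A : Space → ℝ) (i : Fin 3) :
    jetD₁ A i (testJet X p q) = pd (dir p i) A X := by
  simp only [jetD₁, testJet_base, testJet_tangent, pd]

theorem jetD₃_testJet {A : Space → ℝ} (hA : ContDiff ℝ ∞ A) {a b : Fin 2} (hab : a ≠ b)
    (i k l : Fin 3) :
    jetD₃ A i k l (testJet X p q) = pd (dir p i) (pd (dir p k) (pd (dir p l) A)) X
      + (third (q a) l k i * pd (dψ a) A X + third (q b) l k i * pd (dψ b) A X) := by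
  rw [pd_pd_pd hA, ← pd_vertical hab fun d => third (q d) l k i]
  simp [jetD₃, testJet_base, testJet_tangent, testJet_tangent₂, testJet_tangent₃, pd]

theorem prolongation_testJet_one (v : VField) (a : Fin 2) (i : Fin 3) :
    charD₁ v a i (testJet X p q) = testD₁ v X p a i := by
  simp only [charD₁, testD₁, jetD₁_testJet, testJet_one, testJet_two, mul_zero, add_zero]

theorem prolongation_testJet_three (v : VField) {a b : Fin 2} (hab : a ≠ b) (i k l : Fin 3) :
    charD₃ v a i k l (testJet X p q) = testLow v X p a i k l + testTop v X p q a b i k l := by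
  simp only [charD₃, testLow, testTop, jetD₁_testJet, testJet_one, testJet_two, testJet_three,
    testJet_four, jetD₃_testJet X p q (contDiff_eta v a) hab,
    jetD₃_testJet X p q (contDiff_xi v _) hab, Fin.sum_univ_three]
  ring

end testJet

/-- The left-hand side of the system at a test jet. -/
def testSystem (F β : ℝ) (p : Fin 2 → Fin 3 → ℝ) (q : Fin 2 → ℕ → ℕ → ℕ → ℝ) (a b : Fin 2) : ℝ :=
  (q a 1 2 0 + q a 1 0 2 - F * (p a 0 - p b 0))
    + (p a 1 * (q a 0 2 1 + q a 0 0 3 + β - F * (p a 2 - p b 2))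
      - p a 2 * (q a 0 3 0 + q a 0 1 2 - F * (p a 1 - p b 1)))

theorem system_testJet (F β : ℝ) {a b : Fin 2} (hab : a ≠ b) (X : Space) (p : Fin 2 → Fin 3 → ℝ)
    (q : Fin 2 → ℕ → ℕ → ℕ → ℝ) :
    system F β a (testJet X p q) = testSystem F β p q a b := by
  rw [system_eq F β hab]
  simp [testJet, testSystem, order_vec]

/-- The invariance criterion at a test jet. -/
theorem IsLieSymmetry.test {F β : ℝ} {v : VField} (h : IsLieSymmetry F β v) {a b : Fin 2}
    (hab : a ≠ b) (X : Space) (p : Fin 2 → Fin 3 → ℝ) (q : Fin 2 → ℕ → ℕ → ℕ → ℝ)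
    (ha : testSystem F β p q a b = 0) (hb : testSystem F β p q b a = 0) :
    (testLow v X p a 0 1 1 + testTop v X p q a b 0 1 1
      + (testLow v X p a 0 2 2 + testTop v X p q a b 0 2 2)
      - F * (testD₁ v X p a 0 - testD₁ v X p b 0))
    + (testD₁ v X p a 1 * (q a 0 2 1 + q a 0 0 3 + β - F * (p a 2 - p b 2))
      + p a 1 * (testLow v X p a 1 1 2 + testTop v X p q a b 1 1 2
        + (testLow v X p a 2 2 2 + testTop v X p q a b 2 2 2)
        - F * (testD₁ v X p a 2 - testD₁ v X p b 2))
      - (testD₁ v X p a 2 * (q a 0 3 0 + q a 0 1 2 - F * (p a 1 - p b 1))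
        + p a 2 * (testLow v X p a 1 1 1 + testTop v X p q a b 1 1 1
        + (testLow v X p a 1 2 2 + testTop v X p q a b 1 2 2)
        - F * (testD₁ v X p a 1 - testD₁ v X p b 1)))) = 0 := by
  have hS : ∀ d, system F β d (testJet X p q) = 0 := by
    intro d
    obtain rfl | rfl : d = a ∨ d = b := by omega
    · rw [system_testJet F β hab, ha]
    · rw [system_testJet F β hab.symm, hb]
  have h1 := h _ hS a
  rw [lineDeriv_system F β hab] at h1
  have ht (d : Fin 2) := prolongation_snd v (testJet X p q) d ![1, 0, 0]
    (totalDeriv_characteristic v d 0)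
  have hx (d : Fin 2) := prolongation_snd v (testJet X p q) d ![0, 1, 0]
    (totalDeriv_characteristic v d 1)
  have hy (d : Fin 2) := prolongation_snd v (testJet X p q) d ![0, 0, 1]
    (totalDeriv_characteristic v d 2)
  have h3 (i k l : Fin 3) := totalDeriv_totalDeriv_totalDeriv_characteristic v a i k l
  have a1 := prolongation_snd v (testJet X p q) a ![1, 2, 0] (h3 0 1 1)
  have a2 := prolongation_snd v (testJet X p q) a ![1, 0, 2] (h3 0 2 2)
  have a3 := prolongation_snd v (testJet X p q) a ![0, 3, 0] (h3 1 1 1)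
  have a4 := prolongation_snd v (testJet X p q) a ![0, 1, 2] (h3 1 2 2)
  have a5 := prolongation_snd v (testJet X p q) a ![0, 2, 1] (h3 1 1 2)
  have a6 := prolongation_snd v (testJet X p q) a ![0, 0, 3] (h3 2 2 2)
  -- Raising a multi-index of order one or three gives order two or four, where a test jet vanishes.
  have hz (d : Fin 2) (l m n : ℕ) (hn : l + m + n = 1 ∨ l + m + n = 3) :
      ∑ i, xi v i (testJet X p q).base * (testJet X p q).2 d (raise ![l, m, n] i) = 0 := by
    refine Finset.sum_eq_zero fun i _ => ?_
    rcases hn with hn | hn <;> simp [testJet, order_raise, order_vec, hn]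
  rw [hz _ _ _ _ (by simp), add_zero] at a1 a2 a3 a4 a5 a6
  simp only [hz _ _ _ _ (Or.inl (rfl : 1 + 0 + 0 = 1)), hz _ _ _ _ (Or.inl (rfl : 0 + 1 + 0 = 1)),
    hz _ _ _ _ (Or.inl (rfl : 0 + 0 + 1 = 1)), add_zero] at ht hx hy
  rw [prolongation_testJet_three X p q v hab] at a1 a2 a3 a4 a5 a6
  simp only [prolongation_testJet_one] at ht hx hy
  rw [a1, a2, a3, a4, a5, a6, ht, ht, hx, hx, hy, hy] at h1
  simp [testJet, order_vec] at h1
  linarith [h1]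

theorem third_add (q r : ℕ → ℕ → ℕ → ℝ) (i k l : Fin 3) :
    third (q + r) i k l = third q i k l + third r i k l := rfl

theorem testTop_add (v : VField) (X : Space) (p : Fin 2 → Fin 3 → ℝ)
    (q r : Fin 2 → ℕ → ℕ → ℕ → ℝ) (a b : Fin 2) (i k l : Fin 3) :
    testTop v X p (q + r) a b i k l = testTop v X p q a b i k l + testTop v X p r a b i k l := by
  simp only [testTop, Pi.add_apply q r, third_add, Fin.sum_univ_three]
  ring

/-- The invariance criterion, differentiated along third order coordinates. -/
theorem IsLieSymmetry.top {F β : ℝ} {v : VField} (h : IsLieSymmetry F β v) {a b : Fin 2}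
    (hab : a ≠ b) (X : Space) (p : Fin 2 → Fin 3 → ℝ) (q : Fin 2 → ℕ → ℕ → ℕ → ℝ)
    (hq : ∀ d, q d 1 2 0 + q d 1 0 2 + p d 1 * (q d 0 2 1 + q d 0 0 3)
      - p d 2 * (q d 0 3 0 + q d 0 1 2) = 0) :
    testTop v X p q a b 0 1 1 + testTop v X p q a b 0 2 2
      + testD₁ v X p a 1 * (q a 0 2 1 + q a 0 0 3)
      + p a 1 * (testTop v X p q a b 1 1 2 + testTop v X p q a b 2 2 2)
      - testD₁ v X p a 2 * (q a 0 3 0 + q a 0 1 2)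
      - p a 2 * (testTop v X p q a b 1 1 1 + testTop v X p q a b 1 2 2) = 0 := by
  -- A particular solution over the given first order data: `ψᵈ_txx` occurs in the equation of layer
  -- `d` with coefficient one, so it can absorb all other terms.
  let r : Fin 2 → ℕ → ℕ → ℕ → ℝ := fun d l m n => if (l, m, n) = (1, 2, 0) then
    (if d = a then -testSystem F β p 0 a b else -testSystem F β p 0 b a) else 0
  have ha : testSystem F β p r a b = 0 := by
    simp [testSystem, r]
  have hb : testSystem F β p r b a = 0 := by
    simp [testSystem, r, hab.symm]
  have h0 := h.test hab X p r ha hb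
  have h1 := h.test hab X p (r + q)
    (by simp only [testSystem, Pi.add_apply] at ha ⊢; linear_combination ha + hq a)
    (by simp only [testSystem, Pi.add_apply] at hb ⊢; linear_combination hb + hq b)
  simp only [testTop_add, Pi.add_apply] at h1
  linear_combination h1 - h0

/-! ### Determining equations -/

/-- The third order coordinates with a single nonzero entry in layer `a`. -/
def unit (a : Fin 2) (l m n : ℕ) : Fin 2 → ℕ → ℕ → ℕ → ℝ :=
  fun d l' m' n' => if d = a ∧ l' = l ∧ m' = m ∧ n' = n then 1 else 0

/-- The coordinates `ψ_ttx` and `ψ_tty` are absent from the system, hence free, but occur in the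
prolongation along `ψ_txx` and `ψ_tyy` with coefficients `-2 D_x ξᵗ` and `-2 D_y ξᵗ`. -/
theorem IsLieSymmetry.pd_xi_time {F β : ℝ} {v : VField} (h : IsLieSymmetry F β v)
    {k : Fin 3} (hk : k ≠ 0) (w : Fin 2 → ℝ) (X : Space) :
    pd (Pi.single k 1, w) (xi v 0) X = 0 := by
  obtain rfl | rfl : k = 1 ∨ k = 2 := by omega
  · have := h.top zero_ne_one X (fun d _ => w d) (unit 0 2 1 0) (by simp [unit])
    simp [testTop, unit, third, multiIndex_zero, raise_zero, raise_one, raise_two,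
      Fin.sum_univ_three, dir] at this
    linarith
  · have := h.top zero_ne_one X (fun d _ => w d) (unit 0 2 0 1) (by simp [unit])
    simp [testTop, unit, third, multiIndex_zero, raise_zero, raise_one, raise_two,
      Fin.sum_univ_three, dir] at this
    linarith

/-- Third order coordinates of layer `b` enter the criterion for layer `a` only through the
left-hand side below, multiplied by the operator of layer `a`. Layer `b` is advected by its own
velocity, so its equation does not annihilate that factor. -/
theorem IsLieSymmetry.pd_ψ_other {F β : ℝ} {v : VField} (h : IsLieSymmetry F β v)
    {a b : Fin 2} (hab : a ≠ b) (r : Fin 3 → ℝ) (X : Space) :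
    pd (dψ b) (eta v a) X - ∑ m, pd (dψ b) (xi v m) X * r m = 0 := by
  let p : Fin 2 → Fin 3 → ℝ := fun d i => if d = a then r i else r i - 1
  -- The choice `ψᵇ_yyy = 1`, `ψᵇ_tyy = -ψᵇ_x` solves the equation of layer `b`, while the factor
  -- `ψᵇ_tyy + ψᵃ_x ψᵇ_yyy = ψᵃ_x - ψᵇ_x` equals `1` by the shift in `p`.
  have := h.top hab X p (unit b 0 0 3 - p b 1 • unit b 1 0 2) (by
    intro d
    obtain rfl | rfl : d = a ∨ d = b := by omega
    · simp [unit, hab]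
    · simp [unit])
  simp [testTop, unit, third, multiIndex_zero, raise_zero, raise_one, raise_two,
      Fin.sum_univ_three, hab, p, hab.symm] at this
  rw [Fin.sum_univ_three]
  linarith

/-- The relation `pd_ψ_other` is affine in the free first order coordinates `r`, so each coefficient
vanishes. -/
theorem IsLieSymmetry.pd_ψ_xi {F β : ℝ} {v : VField} (h : IsLieSymmetry F β v) (a : Fin 2)
    (m : Fin 3) (X : Space) : pd (dψ a) (xi v m) X = 0 := by
  obtain ⟨b, hab⟩ : ∃ b, b ≠ a := ⟨1 - a, by fin_cases a <;> decide⟩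
  have h0 := h.pd_ψ_other hab 0 X
  have h1 := h.pd_ψ_other hab (Pi.single m 1) X
  simp [Pi.single_apply] at h0 h1
  linarith

theorem IsLieSymmetry.pd_ψ_eta_other {F β : ℝ} {v : VField} (h : IsLieSymmetry F β v)
    {a b : Fin 2} (hab : a ≠ b) (X : Space) : pd (dψ b) (eta v a) X = 0 := by
  simpa using h.pd_ψ_other hab 0 X

theorem IsLieSymmetry.pd_dir_xi {F β : ℝ} {v : VField} (h : IsLieSymmetry F β v)
    (p : Fin 2 → Fin 3 → ℝ) (i m : Fin 3) (X : Space) :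
    pd (dir p i) (xi v m) X = pd (dz i) (xi v m) X := by
  rw [dir, pd_direction zero_ne_one, h.pd_ψ_xi, h.pd_ψ_xi]
  ring

theorem IsLieSymmetry.pd_dir_eta {F β : ℝ} {v : VField} (h : IsLieSymmetry F β v)
    (p : Fin 2 → Fin 3 → ℝ) (i : Fin 3) (a : Fin 2) (X : Space) :
    pd (dir p i) (eta v a) X = pd (dz i) (eta v a) X + p a i * pd (dψ a) (eta v a) X := by
  obtain ⟨b, hab⟩ : ∃ b, a ≠ b := ⟨1 - a, by fin_cases a <;> decide⟩
  rw [dir, pd_direction hab, h.pd_ψ_eta_other hab]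
  ring

theorem IsLieSymmetry.pd_dz_xi_time {F β : ℝ} {v : VField} (h : IsLieSymmetry F β v)
    {k : Fin 3} (hk : k ≠ 0) (X : Space) : pd (dz k) (xi v 0) X = 0 :=
  h.pd_xi_time hk 0 X

/-- Coefficient of the free coordinate `ψ_txy`. Together with `pd_xi_dilation` this says that the
Laplacian in `Qᵃ` is preserved up to a factor. -/
theorem IsLieSymmetry.pd_xi_rotation {F β : ℝ} {v : VField} (h : IsLieSymmetry F β v)
    (X : Space) : pd (dz 2) (xi v 1) X + pd (dz 1) (xi v 2) X = 0 := by
  have := h.top zero_ne_one X 0 (unit 0 1 1 1) (by simp [unit])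
  simp [testTop, unit, third, multiIndex_zero, raise_zero, raise_one, raise_two,
    Fin.sum_univ_three, h.pd_dir_xi] at this
  linarith

theorem IsLieSymmetry.pd_xi_dilation {F β : ℝ} {v : VField} (h : IsLieSymmetry F β v)
    (X : Space) : pd (dz 1) (xi v 1) X = pd (dz 2) (xi v 2) X := by
  have := h.top zero_ne_one X 0 (unit 0 1 2 0 - unit 0 1 0 2) (by simp [unit])
  simp [testTop, unit, third, multiIndex_zero, raise_zero, raise_one, raise_two,
    Fin.sum_univ_three, h.pd_dir_xi] at this
  linarith

/-- With `ψ_x = s` in both layers, `ψᵃ_yyy = 1` is balanced by `ψᵃ_tyy = -s`. The result is affine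
in the arbitrary number `s`, so it contains two determining equations. -/
theorem IsLieSymmetry.pd_x_eta_add {F β : ℝ} {v : VField} (h : IsLieSymmetry F β v)
    (a : Fin 2) (s : ℝ) (X : Space) :
    pd (dz 1) (eta v a) X - pd (dz 0) (xi v 2) X
      + s * (pd (dψ a) (eta v a) X + pd (dz 0) (xi v 0) X - 2 * pd (dz 1) (xi v 1) X) = 0 := by
  obtain ⟨b, hab⟩ : ∃ b, a ≠ b := ⟨1 - a, by fin_cases a <;> decide⟩
  have := h.top hab X (fun _ i => if i = 1 then s else 0) (unit a 0 0 3 - s • unit a 1 0 2) (by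
    intro d; by_cases hd : d = a <;> simp [unit, hd])
  simp [testTop, testD₁, unit, third, multiIndex_zero, raise_zero, raise_one, raise_two,
    Fin.sum_univ_three, h.pd_dir_xi, h.pd_dir_eta, h.pd_ψ_xi, hab.symm] at this
  have h1 := h.pd_xi_dilation X
  rw [← h1] at this
  linear_combination this - 3 * s ^ 2 * h.pd_dz_xi_time (k := 2) (by decide) X

theorem IsLieSymmetry.pd_x_eta {F β : ℝ} {v : VField} (h : IsLieSymmetry F β v)
    (a : Fin 2) (X : Space) : pd (dz 1) (eta v a) X = pd (dz 0) (xi v 2) X := by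
  linear_combination h.pd_x_eta_add a 0 X

theorem IsLieSymmetry.pd_ψ_eta {F β : ℝ} {v : VField} (h : IsLieSymmetry F β v)
    (a : Fin 2) (X : Space) :
    pd (dψ a) (eta v a) X = 2 * pd (dz 1) (xi v 1) X - pd (dz 0) (xi v 0) X := by
  linear_combination h.pd_x_eta_add a 1 X - h.pd_x_eta_add a 0 X

/-- Over vanishing first order coordinates `ψᵃ_xxx` is free; it enters through `-ξˣ_t` in the
component along `ψᵃ_txx` and through the variation of the advecting `ψᵃ_y`. -/
theorem IsLieSymmetry.pd_y_eta {F β : ℝ} {v : VField} (h : IsLieSymmetry F β v)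
    (a : Fin 2) (X : Space) : pd (dz 2) (eta v a) X = - pd (dz 0) (xi v 1) X := by
  obtain ⟨b, hab⟩ : ∃ b, a ≠ b := ⟨1 - a, by fin_cases a <;> decide⟩
  have := h.top hab X 0 (unit a 0 3 0) (by simp [unit])
  simp [testTop, testD₁, unit, third, multiIndex_zero, raise_zero, raise_one, raise_two,
    Fin.sum_univ_three, h.pd_dir_xi, h.pd_dir_eta, hab.symm] at this
  linear_combination -this

/-! ### Determining equations from the terms of low order -/

theorem pd_add_mul {A B : Space → ℝ} (hA : ContDiff ℝ ∞ A) (hB : ContDiff ℝ ∞ B) (c : ℝ)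
    (w X : Space) : pd w (fun Y => A Y + c * B Y) X = pd w A X + c * pd w B X := by
  have h := (smooth_differentiable hA X).hasFDerivAt.fun_add
    ((smooth_differentiable hB X).hasFDerivAt.const_mul c)
  simp [pd, h.fderiv]

theorem pd_zero_fun (w X : Space) : pd w (fun _ => 0) X = 0 := by
  simp [pd]

/-- A function on the base that does not depend on `ψ¹` and `ψ²`. -/
def PsiFree (A : Space → ℝ) : Prop := ∀ a X, pd (dψ a) A X = 0

theorem PsiFree.pd {A : Space → ℝ} (h : PsiFree A) (hA : ContDiff ℝ ∞ A) (w : Space) :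
    PsiFree (pd w A) := fun a X => by
  rw [pd_comm hA, funext (h a)]
  exact pd_zero_fun w X

theorem PsiFree.add_mul {A B : Space → ℝ} (hA : PsiFree A) (hB : PsiFree B)
    (hA' : ContDiff ℝ ∞ A) (hB' : ContDiff ℝ ∞ B) (c : ℝ) :
    PsiFree (fun Y => A Y + c * B Y) := fun a X => by
  rw [pd_add_mul hA' hB', hA, hB, mul_zero, add_zero]

theorem PsiFree.pd_dir {A : Space → ℝ} (h : PsiFree A) (p : Fin 2 → Fin 3 → ℝ) (i : Fin 3) :
    TwoLayer.pd (dir p i) A = TwoLayer.pd (dz i) A := by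
  funext X
  rw [dir, pd_direction zero_ne_one, h, h]
  ring

theorem PsiFree.pd_dir_pd_dir {A : Space → ℝ} (h : PsiFree A) (hA : ContDiff ℝ ∞ A)
    (p : Fin 2 → Fin 3 → ℝ) (i k : Fin 3) :
    TwoLayer.pd (dir p i) (TwoLayer.pd (dir p k) A)
      = TwoLayer.pd (dz i) (TwoLayer.pd (dz k) A) := by
  rw [h.pd_dir, (h.pd hA _).pd_dir]

theorem IsLieSymmetry.psiFree_xi {F β : ℝ} {v : VField} (h : IsLieSymmetry F β v) (m : Fin 3) :
    PsiFree (xi v m) :=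
  fun a X => h.pd_ψ_xi a m X

/-- The spatial derivatives of `ηᵃ` equal time derivatives of `ξʸ` and `-ξˣ`. -/
theorem IsLieSymmetry.psiFree_pd_eta {F β : ℝ} {v : VField} (h : IsLieSymmetry F β v)
    (a : Fin 2) {l : Fin 3} (hl : l ≠ 0) : PsiFree (pd (dz l) (eta v a)) := by
  obtain rfl | rfl : l = 1 ∨ l = 2 := by omega
  · rw [funext (h.pd_x_eta a)]
    exact (h.psiFree_xi 2).pd (contDiff_xi v 2) _
  · intro b X
    have h1 := (h.psiFree_xi 1).pd (contDiff_xi v 1) (dz 0) b X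
    -- The summand `0` and the factor `-1` give the shape required by `pd_add_mul`; the same device
    -- recurs below.
    have h2 : pd (dz 2) (eta v a) = fun Y => 0 + (-1) * pd (dz 0) (xi v 1) Y :=
      funext fun Y => by rw [h.pd_y_eta a]; ring
    rw [h2, pd_add_mul contDiff_const (contDiff_pd (contDiff_xi v 1) _), h1, pd_zero_fun]
    ring

theorem IsLieSymmetry.psiFree_pd_ψ_eta {F β : ℝ} {v : VField} (h : IsLieSymmetry F β v)
    (a : Fin 2) : PsiFree (pd (dψ a) (eta v a)) := by
  have h0 := (h.psiFree_xi 0).pd (contDiff_xi v 0) (dz 0)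
  have h1 := (h.psiFree_xi 1).pd (contDiff_xi v 1) (dz 1)
  intro b X
  have h2 : pd (dψ a) (eta v a)
      = fun Y => (0 + 2 * pd (dz 1) (xi v 1) Y) + (-1) * pd (dz 0) (xi v 0) Y :=
    funext fun Y => by rw [h.pd_ψ_eta a]; ring
  have s0 := contDiff_pd (contDiff_xi v 0) (dz 0)
  have s1 := contDiff_pd (contDiff_xi v 1) (dz 1)
  rw [h2, pd_add_mul (contDiff_const.add (contDiff_const.mul s1)) s0,
    pd_add_mul contDiff_const s1, h0, h1, pd_zero_fun]
  ring

/-- The part of low order of the prolongation in terms of coordinate derivatives. -/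
theorem IsLieSymmetry.testLow_eq {F β : ℝ} {v : VField} (h : IsLieSymmetry F β v)
    (X : Space) (p : Fin 2 → Fin 3 → ℝ) (a : Fin 2) (i k : Fin 3) {l : Fin 3} (hl : l ≠ 0) :
    testLow v X p a i k l = pd (dz i) (pd (dz k) (pd (dz l) (eta v a))) X
      + p a l * pd (dz i) (pd (dz k) (pd (dψ a) (eta v a))) X
      - ∑ m, pd (dz i) (pd (dz k) (pd (dz l) (xi v m))) X * p a m := by
  have s1 := contDiff_pd (contDiff_eta v a) (dz l)
  have s2 := contDiff_pd (contDiff_eta v a) (dψ a)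
  have e : pd (dir p l) (eta v a)
      = fun Y => pd (dz l) (eta v a) Y + p a l * pd (dψ a) (eta v a) Y :=
    funext fun Y => h.pd_dir_eta p l a Y
  have f := (h.psiFree_pd_eta a hl).add_mul (h.psiFree_pd_ψ_eta a) s1 s2 (p a l)
  have e2 : pd (dir p i) (pd (dir p k) (pd (dir p l) (eta v a))) X
      = pd (dz i) (pd (dz k) (pd (dz l) (eta v a))) X
        + p a l * pd (dz i) (pd (dz k) (pd (dψ a) (eta v a))) X := by
    rw [e, f.pd_dir_pd_dir (s1.add (contDiff_const.mul s2)), funext (pd_add_mul s1 s2 (p a l) _),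
      pd_add_mul (contDiff_pd s1 _) (contDiff_pd s2 _)]
  have e3 (m : Fin 3) : pd (dir p i) (pd (dir p k) (pd (dir p l) (xi v m)))
      = pd (dz i) (pd (dz k) (pd (dz l) (xi v m))) := by
    rw [(h.psiFree_xi m).pd_dir,
      ((h.psiFree_xi m).pd (contDiff_xi v m) _).pd_dir_pd_dir (contDiff_pd (contDiff_xi v m) _)]
  simp only [testLow, e2, e3]

theorem IsLieSymmetry.pd_pd_pd_xi_time {F β : ℝ} {v : VField} (h : IsLieSymmetry F β v)
    (X : Space) (i k : Fin 3) {l : Fin 3} (hl : l ≠ 0) :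
    pd (dz i) (pd (dz k) (pd (dz l) (xi v 0))) X = 0 := by
  rw [funext (h.pd_dz_xi_time hl), funext (pd_zero_fun (dz k))]
  exact pd_zero_fun _ X

/-- Under a dilation `ψ_txx` and `F ψ_t` scale with different powers of length. Comparing the zero
jet with a jet where these two terms balance isolates the discrepancy `2 F ξˣ_x`. -/
theorem IsLieSymmetry.pd_x_xi_x {F β : ℝ} {v : VField} (h : IsLieSymmetry F β v) (hF : F ≠ 0)
    (X : Space) : pd (dz 1) (xi v 1) X = 0 := by
  have h0 := h.test zero_ne_one X 0 0 (by simp [testSystem]) (by simp [testSystem])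
  -- Here `ψ¹_t = 1`; the values `ψ¹_txx = F` and `ψ²_txx = -F` compensate the coupling terms of the
  -- two layers.
  have h1 := h.test zero_ne_one X (fun d i => if d = 0 ∧ i = 0 then 1 else 0)
    (F • unit 0 1 2 0 - F • unit 1 1 2 0) (by simp [testSystem, unit]) (by simp [testSystem, unit])
  simp [testTop, testD₁, unit, third, multiIndex_zero, raise_zero, raise_one, raise_two,
    Fin.sum_univ_three, h.pd_dir_xi, h.pd_dir_eta, h.pd_ψ_xi, h.pd_ψ_eta_other zero_ne_one,
    h.testLow_eq, h.pd_pd_pd_xi_time] at h0 h1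
  have : F * pd (dz 1) (xi v 1) X = 0 := by
    linear_combination (h0 - h1 - β * h.pd_dz_xi_time (k := 1) (by decide) X) / 2
  exact (mul_eq_zero.1 this).resolve_left hF

theorem IsLieSymmetry.pd_y_xi_y {F β : ℝ} {v : VField} (h : IsLieSymmetry F β v) (hF : F ≠ 0)
    (X : Space) : pd (dz 2) (xi v 2) X = 0 := by
  rw [← h.pd_xi_dilation, h.pd_x_xi_x hF]

/-- At each time `(ξˣ, ξʸ)` is now a Killing field of the plane, hence affine: for instance `ξˣ_yy =
-ξʸ_xy = 0`. -/
theorem IsLieSymmetry.pd_pd_xi {F β : ℝ} {v : VField} (h : IsLieSymmetry F β v) (hF : F ≠ 0)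
    {k l : Fin 3} (hk : k ≠ 0) (hl : l ≠ 0) (m : Fin 3) (X : Space) :
    pd (dz k) (pd (dz l) (xi v m)) X = 0 := by
  have hxx (w : Space) : pd w (pd (dz 1) (xi v 1)) X = 0 := by
    rw [funext (h.pd_x_xi_x hF), pd_zero_fun]
  have hyy (w : Space) : pd w (pd (dz 2) (xi v 2)) X = 0 := by
    rw [funext (h.pd_y_xi_y hF), pd_zero_fun]
  have e1 : pd (dz 2) (xi v 1) = fun Y => 0 + (-1) * pd (dz 1) (xi v 2) Y :=
    funext fun Y => by linear_combination h.pd_xi_rotation Y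
  have e2 : pd (dz 1) (xi v 2) = fun Y => 0 + (-1) * pd (dz 2) (xi v 1) Y :=
    funext fun Y => by linear_combination h.pd_xi_rotation Y
  have c1 := contDiff_xi v 1
  have c2 := contDiff_xi v 2
  obtain rfl | rfl | rfl : m = 0 ∨ m = 1 ∨ m = 2 := by omega
  · rw [funext (h.pd_dz_xi_time hl), pd_zero_fun]
  · obtain rfl | rfl : l = 1 ∨ l = 2 := by omega
    · exact hxx _
    · obtain rfl | rfl : k = 1 ∨ k = 2 := by omega
      · rw [pd_comm c1, hxx]
      · rw [e1, pd_add_mul contDiff_const (contDiff_pd c2 _), pd_comm c2, hyy, pd_zero_fun]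
        ring
  · obtain rfl | rfl : l = 1 ∨ l = 2 := by omega
    · obtain rfl | rfl : k = 1 ∨ k = 2 := by omega
      · rw [e2, pd_add_mul contDiff_const (contDiff_pd c1 _), pd_comm c1, hxx, pd_zero_fun]
        ring
      · rw [pd_comm c2, hyy]
    · exact hyy _

theorem IsLieSymmetry.pd_pd_pd_xi {F β : ℝ} {v : VField} (h : IsLieSymmetry F β v) (hF : F ≠ 0)
    (i : Fin 3) {k l : Fin 3} (hk : k ≠ 0) (hl : l ≠ 0) (m : Fin 3) (X : Space) :
    pd (dz i) (pd (dz k) (pd (dz l) (xi v m))) X = 0 := by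
  rw [funext (h.pd_pd_xi hF hk hl m), pd_zero_fun]

theorem IsLieSymmetry.pd_ψ_eta_eq {F β : ℝ} {v : VField} (h : IsLieSymmetry F β v) (hF : F ≠ 0)
    (a : Fin 2) (X : Space) : pd (dψ a) (eta v a) X = 0 + (-1) * pd (dz 0) (xi v 0) X := by
  rw [h.pd_ψ_eta, h.pd_x_xi_x hF]
  ring

/-- The right-hand side no longer involves `p`, so these terms cancel when test jets over one point
are compared. -/
theorem IsLieSymmetry.testLow_eq' {F β : ℝ} {v : VField} (h : IsLieSymmetry F β v) (hF : F ≠ 0)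
    (X : Space) (p : Fin 2 → Fin 3 → ℝ) (a : Fin 2) (i : Fin 3) {k l : Fin 3} (hk : k ≠ 0)
    (hl : l ≠ 0) :
    testLow v X p a i k l = pd (dz i) (pd (dz k) (pd (dz l) (eta v a))) X := by
  have c0 := contDiff_xi v 0
  have e : pd (dz k) (pd (dψ a) (eta v a)) = fun _ => 0 := by
    funext Y
    rw [funext (h.pd_ψ_eta_eq hF a), pd_add_mul contDiff_const (contDiff_pd c0 _), pd_comm c0,
      funext (h.pd_dz_xi_time hk), pd_zero_fun, pd_zero_fun]
    ring
  simp [h.testLow_eq X p a i k hl, h.pd_pd_pd_xi hF i hk hl, e, pd_zero_fun]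

/-- One spatial derivative turns `ηᵃ` into a time derivative of `ξ`, and `ξ` is affine in space. -/
theorem IsLieSymmetry.pd_pd_pd_eta {F β : ℝ} {v : VField} (h : IsLieSymmetry F β v) (hF : F ≠ 0)
    {i k l : Fin 3} (hi : i ≠ 0) (hk : k ≠ 0) (hl : l ≠ 0) (a : Fin 2) (X : Space) :
    pd (dz i) (pd (dz k) (pd (dz l) (eta v a))) X = 0 := by
  have key (m : Fin 3) : pd (dz i) (pd (dz k) (pd (dz 0) (xi v m))) X = 0 := by
    have c := contDiff_xi v m
    rw [pd_comm c (dz k), pd_comm (contDiff_pd c _), funext (h.pd_pd_xi hF hi hk m), pd_zero_fun]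
  obtain rfl | rfl : l = 1 ∨ l = 2 := by omega
  · rw [funext (h.pd_x_eta a), key]
  · have e : pd (dz 2) (eta v a) = fun Y => 0 + (-1) * pd (dz 0) (xi v 1) Y :=
      funext fun Y => by rw [h.pd_y_eta a]; ring
    have c := contDiff_pd (contDiff_xi v 1) (dz 0)
    rw [e, funext (pd_add_mul contDiff_const c _ (dz k)),
      pd_add_mul (contDiff_pd contDiff_const _) (contDiff_pd c _), key,
      funext (pd_zero_fun (dz k)), pd_zero_fun]
    ring

theorem IsLieSymmetry.pd_t_xi_t {F β : ℝ} {v : VField} (h : IsLieSymmetry F β v) (hF : F ≠ 0)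
    (hβ : β ≠ 0) (X : Space) : pd (dz 0) (xi v 0) X = 0 := by
  have h0 := h.test zero_ne_one X 0 0 (by simp [testSystem]) (by simp [testSystem])
  -- With `ψ_x = 1` in both layers the term `β ψ_x` is balanced by `ψ_txx = -β`. The two scale
  -- differently in time, and the difference to the zero jet is `β ξᵗ_t`.
  have h1 := h.test zero_ne_one X (fun d i => if i = 1 then 1 else 0)
    ((-β) • (unit 0 1 2 0 + unit 1 1 2 0)) (by simp [testSystem, unit])
    (by simp [testSystem, unit])
  simp [testTop, testD₁, unit, third, multiIndex_zero, raise_zero, raise_one, raise_two,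
    Fin.sum_univ_three, h.pd_dir_xi, h.pd_dir_eta, h.pd_ψ_xi, h.pd_ψ_eta_other zero_ne_one,
    h.testLow_eq' hF, h.pd_pd_pd_eta hF, h.pd_x_xi_x hF, h.pd_ψ_eta_eq hF, h.pd_y_eta,
    h.pd_x_eta] at h0 h1
  have : β * pd (dz 0) (xi v 0) X = 0 := by
    linear_combination h1 - h0 - β * h.pd_dz_xi_time (k := 2) (by decide) X
  exact (mul_eq_zero.1 this).resolve_left hβ

theorem IsLieSymmetry.pd_ψ_eta_self {F β : ℝ} {v : VField} (h : IsLieSymmetry F β v) (hF : F ≠ 0)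
    (hβ : β ≠ 0) (a : Fin 2) (X : Space) : pd (dψ a) (eta v a) X = 0 := by
  rw [h.pd_ψ_eta_eq hF, h.pd_t_xi_t hF hβ]
  ring

/-- A rotation mixes `ψ_y` into `ψ_x`, on which `β` acts. The jet with only `ψ_y = 1`, equal in both
layers, solves the system and detects this. -/
theorem IsLieSymmetry.pd_x_xi_y {F β : ℝ} {v : VField} (h : IsLieSymmetry F β v) (hF : F ≠ 0)
    (hβ : β ≠ 0) (X : Space) : pd (dz 1) (xi v 2) X = 0 := by
  have h0 := h.test zero_ne_one X 0 0 (by simp [testSystem]) (by simp [testSystem])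
  have h1 := h.test zero_ne_one X (fun d i => if i = 2 then 1 else 0) 0 (by simp [testSystem])
    (by simp [testSystem])
  simp [testTop, testD₁, third, h.pd_dir_xi, h.pd_dir_eta, h.pd_ψ_xi, h.testLow_eq' hF,
    h.pd_pd_pd_eta hF, h.pd_ψ_eta_self hF hβ, h.pd_y_eta, h.pd_x_eta] at h0 h1
  have : β * pd (dz 1) (xi v 2) X = 0 := by linear_combination h0 - h1
  exact (mul_eq_zero.1 this).resolve_left hβ

theorem IsLieSymmetry.pd_y_xi_x {F β : ℝ} {v : VField} (h : IsLieSymmetry F β v) (hF : F ≠ 0)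
    (hβ : β ≠ 0) (X : Space) : pd (dz 2) (xi v 1) X = 0 := by
  linear_combination h.pd_xi_rotation X - h.pd_x_xi_y hF hβ X

/-- At the zero jet the criterion reads `ηᵃ_txx + ηᵃ_tyy + β ηᵃ_x = F (ηᵃ_t - ηᵇ_t)`, where the
first two terms vanish and `ηᵃ_x = ξʸ_t`. -/
theorem IsLieSymmetry.pd_t_eta_relation {F β : ℝ} {v : VField} (h : IsLieSymmetry F β v)
    (hF : F ≠ 0) (hβ : β ≠ 0) {a b : Fin 2} (hab : a ≠ b) (X : Space) :
    β * pd (dz 0) (xi v 2) X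
      = F * (pd (dz 0) (eta v a) X - pd (dz 0) (eta v b) X) := by
  have h0 := h.test hab X 0 0 (by simp [testSystem]) (by simp [testSystem])
  have c1 := contDiff_xi v 1
  have c2 := contDiff_xi v 2
  have ex : pd (dz 1) (pd (dz 1) (eta v a)) = fun _ => 0 := by
    rw [funext (h.pd_x_eta a), pd_comm c2, funext (h.pd_x_xi_y hF hβ), funext (pd_zero_fun (dz 0))]
  have ey : pd (dz 2) (pd (dz 2) (eta v a)) = fun _ => 0 := by
    have e : pd (dz 2) (eta v a) = fun Y => 0 + (-1) * pd (dz 0) (xi v 1) Y :=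
      funext fun Y => by rw [h.pd_y_eta a]; ring
    funext Y
    rw [e, pd_add_mul contDiff_const (contDiff_pd c1 _), pd_comm c1,
      funext (h.pd_y_xi_x hF hβ), pd_zero_fun, pd_zero_fun]
    ring
  simp [testTop, testD₁, third, h.pd_dir_eta, h.testLow_eq' hF, ex, ey, pd_zero_fun,
    h.pd_x_eta] at h0
  linear_combination h0

/-- Adding `pd_t_eta_relation` for both orders of the layers cancels the antisymmetric right-hand
side. -/
theorem IsLieSymmetry.pd_t_xi_y {F β : ℝ} {v : VField} (h : IsLieSymmetry F β v)
    (hF : F ≠ 0) (hβ : β ≠ 0) (X : Space) : pd (dz 0) (xi v 2) X = 0 := by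
  have h0 := h.pd_t_eta_relation hF hβ zero_ne_one X
  have h1 := h.pd_t_eta_relation hF hβ one_ne_zero X
  have : β * pd (dz 0) (xi v 2) X = 0 := by linear_combination (h0 + h1) / 2
  exact (mul_eq_zero.1 this).resolve_left hβ

theorem IsLieSymmetry.pd_t_eta {F β : ℝ} {v : VField} (h : IsLieSymmetry F β v)
    (hF : F ≠ 0) (hβ : β ≠ 0) (X : Space) :
    pd (dz 0) (eta v 0) X = pd (dz 0) (eta v 1) X := by
  have h0 := h.pd_t_eta_relation hF hβ zero_ne_one X
  rw [h.pd_t_xi_y hF hβ, mul_zero] at h0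
  linarith [(mul_eq_zero.1 h0.symm).resolve_left hF]

/-! ### Integration of the determining equations -/

theorem hasDerivAt_line_at {A : Space → ℝ} (hA : ContDiff ℝ ∞ A) (X w : Space) (s : ℝ) :
    HasDerivAt (fun s : ℝ => A (X + s • w)) (pd w A (X + s • w)) s := by
  have h : HasDerivAt (fun s : ℝ => X + s • w) w s := by
    simpa using ((hasDerivAt_id s).smul_const w).const_add X
  exact (smooth_differentiable hA (X + s • w)).hasFDerivAt.comp_hasDerivAt s h

/-- After subtraction of `s * c` the function is constant along the line; the values at `s = 1` and
`s = 0` are compared. -/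
theorem eq_add_of_pd_eq {A : Space → ℝ} (hA : ContDiff ℝ ∞ A) {X w : Space} {c : ℝ}
    (h : ∀ s : ℝ, pd w A (X + s • w) = c) : A (X + w) = A X + c := by
  have hd (s : ℝ) : HasDerivAt (fun s : ℝ => A (X + s • w) - s * c) 0 s := by
    have h1 := (hasDerivAt_line_at hA X w s).sub ((hasDerivAt_id s).mul_const c)
    rw [h s, one_mul, sub_self] at h1
    exact h1
  have h2 := is_const_of_deriv_eq_zero (fun s => (hd s).differentiableAt)
    (fun s => (hd s).deriv) 1 0
  simp only [one_smul, zero_smul, one_mul, zero_mul, add_zero, sub_zero] at h2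
  linarith

theorem pd_eq_sum (A : Space → ℝ) (w X : Space) :
    pd w A X = ∑ i, w.1 i * pd (dz i) A X + ∑ a, w.2 a * pd (dψ a) A X := by
  have hw : w = ∑ i, w.1 i • dz i + ∑ a, w.2 a • dψ a := by
    refine Prod.ext (funext fun i => ?_) (funext fun a => ?_)
    · fin_cases i <;> simp [dz, dψ, Fin.sum_univ_three]
    · fin_cases a <;> simp [dz, dψ, Fin.sum_univ_three]
  conv_lhs => rw [hw]
  simp only [Fin.sum_univ_three, Fin.sum_univ_two, pd_add_dir, pd_smul_dir]

theorem eq_of_pd_eq_zero {A : Space → ℝ} (hA : ContDiff ℝ ∞ A) (hψ : PsiFree A)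
    (hz : ∀ i X, pd (dz i) A X = 0) (X : Space) : A X = A 0 := by
  have h := eq_add_of_pd_eq hA (X := 0) (w := X) (c := 0) fun s => by
    simp [pd_eq_sum A X, hψ _ _, hz]
  simpa using h

/-- The displacement from `X` to the `t`-axis. -/
def toAxis (X : Space) : Space := X.1 0 • dz 0 - X

theorem pd_toAxis {A : Space → ℝ} (hψ : PsiFree A) (X Y : Space) :
    pd (toAxis X) A Y = - X.1 1 * pd (dz 1) A Y - X.1 2 * pd (dz 2) A Y := by
  rw [pd_eq_sum]
  simp [hψ _ _, Fin.sum_univ_three, toAxis, dz]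
  ring

theorem eq_on_axis {A : Space → ℝ} (hA : ContDiff ℝ ∞ A) (hψ : PsiFree A)
    (hx : ∀ X, pd (dz 1) A X = 0) (hy : ∀ X, pd (dz 2) A X = 0) (X : Space) :
    A (X.1 0 • dz 0) = A X := by
  have h := eq_add_of_pd_eq hA (X := X) (w := toAxis X) (c := 0) fun s => by
    simp [pd_toAxis hψ, hx, hy]
  simpa [toAxis] using h

/-- The restriction of a smooth function to the `t`-axis. -/
def axis {A : Space → ℝ} (hA : ContDiff ℝ ∞ A) : smoothFunctions :=
  ⟨fun t => A (t • dz 0), mem_smoothFunctions.2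
    (hA.comp (contDiff_id.smul contDiff_const))⟩

theorem deriv_axis {A : Space → ℝ} (hA : ContDiff ℝ ∞ A) (t : ℝ) :
    deriv (axis hA).1 t = pd (dz 0) A (t • dz 0) := by
  have h := (hasDerivAt_line_at hA 0 (dz 0) t).deriv
  simpa [axis] using h

theorem IsLieSymmetry.exists_normalForm {F β : ℝ} {v : VField} (h : IsLieSymmetry F β v)
    (hF : F ≠ 0) (hβ : β ≠ 0) : ∃ c, v = normalForm c := by
  have cx := contDiff_xi v 1
  let f : smoothFunctions := axis cx
  have hC (X : Space) : deriv f.1 (X.1 0) = pd (dz 0) (xi v 1) X := by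
    rw [deriv_axis cx]
    refine eq_on_axis (contDiff_pd cx _) ((h.psiFree_xi 1).pd cx _) (fun Y => ?_) (fun Y => ?_) X
    · rw [pd_comm cx, funext (h.pd_x_xi_x hF), pd_zero_fun]
    · rw [pd_comm cx, funext (h.pd_y_xi_x hF hβ), pd_zero_fun]
  have hψ (a : Fin 2) : PsiFree (eta v a) := fun b X => by
    by_cases hab : a = b
    · rw [← hab, h.pd_ψ_eta_self hF hβ]
    · exact h.pd_ψ_eta_other hab X
  -- On the line from `X` to the `t`-axis `t` is fixed, and the derivative of `ηᵃ` along `toAxis X`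
  -- is the constant `f'(t) y`, with `y` taken at `X`.
  have hη (a : Fin 2) (X : Space) :
      eta v a (X.1 0 • dz 0) = eta v a X + deriv f.1 (X.1 0) * X.1 2 := by
    have h1 := eq_add_of_pd_eq (contDiff_eta v a) (X := X) (w := toAxis X)
      (c := deriv f.1 (X.1 0) * X.1 2) fun s => by
        have h2 : (X + s • toAxis X).1 0 = X.1 0 := by simp [toAxis, dz]
        rw [pd_toAxis (hψ a), h.pd_x_eta, h.pd_t_xi_y hF hβ, h.pd_y_eta, ← hC, h2]
        ring
    simpa [toAxis] using h1
  have hdiff (t : ℝ) : eta v 0 (t • dz 0) - eta v 1 (t • dz 0) = eta v 0 0 - eta v 1 0 := by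
    have h1 := eq_add_of_pd_eq (A := fun Y => eta v 0 Y + (-1) * eta v 1 Y)
      ((contDiff_eta v 0).add (contDiff_const.mul (contDiff_eta v 1))) (X := 0) (w := t • dz 0)
      (c := 0) fun s => by
        rw [pd_add_mul (contDiff_eta v 0) (contDiff_eta v 1), pd_smul_dir, pd_smul_dir,
          h.pd_t_eta hF hβ]
        ring
    simp only [zero_add] at h1
    linarith
  -- On the axis half the sum of `η¹` and `η²` is `g`; half their difference, constant by `hdiff`,
  -- is the coefficient of `𝓕`.
  let g : smoothFunctions :=
    (1 / 2 : ℝ) • (axis (contDiff_eta v 0) + axis (contDiff_eta v 1))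
  have hg (t : ℝ) : g.1 t = (eta v 0 (t • dz 0) + eta v 1 (t • dz 0)) / 2 := by
    simp [g, axis]; ring
  refine ⟨(xi v 0 0, xi v 2 0, (eta v 0 0 - eta v 1 0) / 2, f, g), ?_⟩
  ext1
  funext X
  rw [normalForm_apply]
  have hz0 : xi v 0 X = xi v 0 0 := eq_of_pd_eq_zero (contDiff_xi v 0) (h.psiFree_xi 0)
    (fun i Y => by
      by_cases hi : i = 0
      · rw [hi, h.pd_t_xi_t hF hβ]
      · exact h.pd_dz_xi_time hi Y) X
  have hz2 : xi v 2 X = xi v 2 0 := eq_of_pd_eq_zero (contDiff_xi v 2) (h.psiFree_xi 2)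
    (fun i Y => by
      obtain rfl | rfl | rfl : i = 0 ∨ i = 1 ∨ i = 2 := by omega
      · exact h.pd_t_xi_y hF hβ Y
      · exact h.pd_x_xi_y hF hβ Y
      · exact h.pd_y_xi_y hF Y) X
  have hz1 : f.1 (X.1 0) = xi v 1 X :=
    eq_on_axis cx (h.psiFree_xi 1) (h.pd_x_xi_x hF) (h.pd_y_xi_x hF hβ) X
  refine Prod.ext (funext fun i => ?_) (funext fun a => ?_)
  · obtain rfl | rfl | rfl : i = 0 ∨ i = 1 ∨ i = 2 := by omega
    · exact hz0
    · exact hz1.symm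
    · exact hz2
  · have h0 := hη 0 X
    have h1 := hη 1 X
    have h2 := hdiff (X.1 0)
    have h3 := hg (X.1 0)
    obtain rfl | rfl : a = 0 ∨ a = 1 := by omega
    · change eta v 0 X = _ / 2 - _ + g.1 (X.1 0)
      linarith
    · change eta v 1 X = -(_ / 2) - _ + g.1 (X.1 0)
      linarith

theorem isLieSymmetry_iff {F β : ℝ} (hF : F ≠ 0) (hβ : β ≠ 0) (v : VField) :
    IsLieSymmetry F β v ↔ ∃ c, v = normalForm c :=
  ⟨fun h => h.exists_normalForm hF hβ, fun ⟨c, hc⟩ => hc ▸ isLieSymmetry_normalForm F β c⟩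

/-! ### The structure of the algebra -/

/-- The parameters `(a, b, c, f, g)` of a normal form. -/
abbrev Params : Type := ℝ × ℝ × ℝ × smoothFunctions × smoothFunctions

theorem deriv_smoothFunction_add (f g : smoothFunctions) (t : ℝ) :
    deriv ((f : ℝ → ℝ) + (g : ℝ → ℝ)) t = deriv f.1 t + deriv g.1 t :=
  deriv_add (differentiable_smoothFunction f t) (differentiable_smoothFunction g t)

theorem deriv_smoothFunction_smul (r : ℝ) (f : smoothFunctions) (t : ℝ) :
    deriv (r • (f : ℝ → ℝ)) t = r * deriv f.1 t :=
  deriv_const_mul r (differentiable_smoothFunction f t)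

/-- The normal form as a linear function of its parameters. -/
def normalFormLinear : Params →ₗ[ℝ] VField where
  toFun := normalForm
  map_add' c d := by
    ext1; funext p
    change (normalForm (c + d)).1 p = (normalForm c).1 p + (normalForm d).1 p
    simp only [normalForm_apply]
    refine Prod.ext (funext fun i => ?_) (funext fun i => ?_)
    · fin_cases i <;> simp
    · fin_cases i <;> simp [deriv_smoothFunction_add] <;> ring
  map_smul' r c := by
    ext1; funext p
    change (normalForm (r • c)).1 p = r • (normalForm c).1 p
    simp only [normalForm_apply]
    refine Prod.ext (funext fun i => ?_) (funext fun i => ?_)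
    · fin_cases i <;> simp
    · fin_cases i <;> simp [deriv_smoothFunction_smul] <;> ring

/-- On the `t`-axis `y = 0` removes the terms with `f'`, so the two vertical components are `c + g`
and `-c + g`. -/
theorem normalForm_injective : Function.Injective normalForm := by
  intro c d h
  have key (p : Space) : (normalForm c).1 p = (normalForm d).1 p := by rw [h]
  simp only [normalForm_apply, Prod.mk.injEq] at key
  have hz (p : Space) (i : Fin 3) := congrFun (key p).1 i
  have hψ (p : Space) (a : Fin 2) := congrFun (key p).2 a
  have hf : c.2.2.2.1 = d.2.2.2.1 := by
    ext1; funext t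
    simpa [dz] using hz (t • dz 0) 1
  have h0 (t : ℝ) := hψ (t • dz 0) 0
  have h1 (t : ℝ) := hψ (t • dz 0) 1
  simp [dz] at h0 h1
  have hc : c.2.2.1 = d.2.2.1 := by linarith [h0 0, h1 0]
  have hg : c.2.2.2.2 = d.2.2.2.2 := by
    ext1; funext t
    linarith [h0 t, h1 t]
  exact Prod.ext (hz 0 0) (Prod.ext (hz 0 2) (Prod.ext hc (Prod.ext hf hg)))

theorem fderiv_normalForm (c : Params) (p w : Space) :
    fderiv ℝ (normalForm c).1 p w = (![0, deriv c.2.2.2.1.1 (p.1 0) * w.1 0, 0],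
      fun _ => -(deriv (deriv c.2.2.2.1.1) (p.1 0) * w.1 0 * p.1 2
          + deriv c.2.2.2.1.1 (p.1 0) * w.1 2) + deriv c.2.2.2.2.1 (p.1 0) * w.1 0) := by
  -- The Fréchet derivative applied to `w` is the derivative along a line, which is then computed
  -- componentwise and identified by uniqueness.
  have hl : HasDerivAt (fun s : ℝ => (normalForm c).1 (p + s • w))
      (fderiv ℝ (normalForm c).1 p w) 0 := by
    have h := ((normalForm c).differentiableAt (p + (0 : ℝ) • w)).hasFDerivAt.comp_hasDerivAt
      (0 : ℝ) (hasDerivAt_line p w)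
    simpa [Function.comp_def] using h
  have ht (i : Fin 3) : HasDerivAt (fun s : ℝ => (p + s • w).1 i) (w.1 i) 0 := by
    simpa using ((hasDerivAt_id (0 : ℝ)).mul_const (w.1 i)).const_add (p.1 i)
  have hcomp (f : smoothFunctions) :
      HasDerivAt (fun s : ℝ => f.1 ((p + s • w).1 0)) (deriv f.1 (p.1 0) * w.1 0) 0 := by
    have h := (differentiable_smoothFunction f ((p + (0 : ℝ) • w).1 0)).hasDerivAt.comp (0 : ℝ)
      (ht 0)
    simpa [Function.comp_def] using h
  have hη (ε : ℝ) := (((hcomp (smoothDeriv c.2.2.2.1)).fun_mul (ht 2)).const_sub ε).fun_add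
    (hcomp c.2.2.2.2)
  refine hl.unique ?_
  simp only [normalForm_apply]
  refine HasDerivAt.prodMk (hasDerivAt_pi.2 fun i => ?_) (hasDerivAt_pi.2 fun a => ?_)
  · fin_cases i
    · exact hasDerivAt_const _ _
    · exact hcomp c.2.2.2.1
    · exact hasDerivAt_const _ _
  · fin_cases a
    · have h := hη c.2.2.1
      simp only [zero_smul, add_zero] at h
      exact h
    · have h := hη (-c.2.2.1)
      simp only [zero_smul, add_zero] at h
      exact h

/-- The parameters of the commutator of two normal forms. -/
def bracketParams (c d : Params) : Params :=
  (0, 0, 0, c.1 • smoothDeriv d.2.2.2.1 - d.1 • smoothDeriv c.2.2.2.1,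
    c.1 • smoothDeriv d.2.2.2.2 - d.1 • smoothDeriv c.2.2.2.2
      - c.2.1 • smoothDeriv d.2.2.2.1 + d.2.1 • smoothDeriv c.2.2.2.1)

theorem bracket_normalForm (c d : Params) :
    ⁅normalForm c, normalForm d⁆ = normalForm (bracketParams c d) := by
  ext1; funext p
  have hd : deriv (bracketParams c d).2.2.2.1.1 (p.1 0)
      = c.1 * deriv (deriv d.2.2.2.1.1) (p.1 0) - d.1 * deriv (deriv c.2.2.2.1.1) (p.1 0) := by
    have e : (bracketParams c d).2.2.2.1
        = c.1 • smoothDeriv d.2.2.2.1 + (-d.1) • smoothDeriv c.2.2.2.1 := by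
      ext1; funext t
      simp [bracketParams]
      ring
    rw [e, Submodule.coe_add, deriv_smoothFunction_add, Submodule.coe_smul, Submodule.coe_smul,
      deriv_smoothFunction_smul, deriv_smoothFunction_smul]
    simp only [smoothDeriv]
    ring
  rw [VField.bracket_apply, VectorField.lieBracket, fderiv_normalForm, fderiv_normalForm,
    normalForm_apply (bracketParams c d), hd]
  simp only [normalForm_apply]
  refine Prod.ext (funext fun i => ?_) (funext fun i => ?_)
  · fin_cases i <;> simp [bracketParams, smoothDeriv]
    ring
  · fin_cases i <;> simp [bracketParams, smoothDeriv] <;> ring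

/-- The Lie algebra of all normal forms. -/
def normalFormAlgebra : LieSubalgebra ℝ VField :=
  { LinearMap.range normalFormLinear with
    lie_mem' := by
      rintro _ _ ⟨c, rfl⟩ ⟨d, rfl⟩
      exact ⟨bracketParams c d, (bracket_normalForm c d).symm⟩ }

theorem mem_normalFormAlgebra {v : VField} : v ∈ normalFormAlgebra ↔ ∃ c, v = normalForm c :=
  ⟨fun ⟨c, hc⟩ => ⟨c, hc.symm⟩, fun ⟨c, hc⟩ => ⟨c, hc.symm⟩⟩

theorem fieldX_zero : fieldX 0 = 0 := by
  ext1; funext p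
  refine Prod.ext (funext fun i => ?_) (funext fun i => ?_) <;> fin_cases i <;> simp [fieldX]

theorem fieldZ_zero : fieldZ 0 = 0 := by
  ext1; funext p
  refine Prod.ext (funext fun i => ?_) (funext fun i => ?_) <;> fin_cases i <;> simp [fieldZ]

theorem normalFormAlgebra_eq_span : normalFormAlgebra.toSubmodule = Submodule.span ℝ
    ({fieldT, fieldY, fieldF} ∪ Set.range fieldX ∪ Set.range fieldZ) := by
  refine le_antisymm ?_ (Submodule.span_le.2 ?_)
  · rintro _ ⟨c, rfl⟩
    change normalForm c ∈ _
    have m {x : VField} (hx : x ∈ ({fieldT, fieldY, fieldF} ∪ Set.range fieldX ∪ Set.range fieldZ :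
        Set VField)) := Submodule.subset_span (R := ℝ) hx
    refine add_mem (add_mem (add_mem (add_mem (Submodule.smul_mem _ _ (m ?_))
      (Submodule.smul_mem _ _ (m ?_))) (Submodule.smul_mem _ _ (m ?_))) (m ?_)) (m ?_) <;> simp
  · have m {x : VField} (c : Params) (hx : x = normalForm c) :
        x ∈ normalFormAlgebra.toSubmodule := mem_normalFormAlgebra.2 ⟨c, hx⟩
    rintro x ((hx | ⟨f, rfl⟩) | ⟨g, rfl⟩)
    · rcases hx with rfl | rfl | rfl
      · exact m (1, 0, 0, 0, 0) (by simp [normalForm, fieldX_zero, fieldZ_zero])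
      · exact m (0, 1, 0, 0, 0) (by simp [normalForm, fieldX_zero, fieldZ_zero])
      · exact m (0, 0, 1, 0, 0) (by simp [normalForm, fieldX_zero, fieldZ_zero])
    · exact m (0, 0, 0, f, 0) (by simp [normalForm, fieldZ_zero])
    · exact m (0, 0, 0, 0, g) (by simp [normalForm, fieldX_zero])

/-! ### Infinite dimension and solvability -/

/-- Polynomials as smooth functions. -/
def polynomialFunction : Polynomial ℝ →ₗ[ℝ] smoothFunctions where
  toFun P := ⟨fun t => P.eval t, mem_smoothFunctions.2 (by simpa using P.contDiff_aeval (𝕜 := ℝ) ∞)⟩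
  map_add' P Q := by ext1; funext t; simp
  map_smul' r P := by ext1; funext t; simp

theorem not_finiteDimensional_normalFormAlgebra : ¬ FiniteDimensional ℝ normalFormAlgebra := by
  intro hfin
  -- The map `P ↦ 𝓩(P)` embeds the polynomials.
  let φ : Polynomial ℝ →ₗ[ℝ] normalFormAlgebra.toSubmodule :=
    normalFormLinear.rangeRestrict ∘ₗ LinearMap.inr ℝ ℝ _ ∘ₗ LinearMap.inr ℝ ℝ _ ∘ₗ
      LinearMap.inr ℝ ℝ _ ∘ₗ LinearMap.inr ℝ smoothFunctions _ ∘ₗ polynomialFunction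
  have hφ : Function.Injective φ := by
    intro P Q hPQ
    have h1 : normalForm (0, 0, 0, 0, polynomialFunction P)
        = normalForm (0, 0, 0, 0, polynomialFunction Q) := congrArg Subtype.val hPQ
    have h2 : polynomialFunction P = polynomialFunction Q :=
      congrArg (fun c : Params => c.2.2.2.2) (normalForm_injective h1)
    exact Polynomial.funext fun t => congrFun (congrArg Subtype.val h2) t
  have : Module.Finite ℝ normalFormAlgebra.toSubmodule := hfin
  exact Polynomial.not_finite (Module.Finite.of_injective φ hφ)

/-- The ideal of the fields `𝓧(f) + 𝓩(g)`. -/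
def abelianIdeal : LieIdeal ℝ normalFormAlgebra where
  carrier := {x | ∃ f g, x.1 = normalForm (0, 0, 0, f, g)}
  zero_mem' := ⟨0, 0, (map_zero normalFormLinear).symm⟩
  add_mem' := by
    rintro x y ⟨f, g, hx⟩ ⟨f', g', hy⟩
    refine ⟨f + f', g + g', ?_⟩
    have h := map_add normalFormLinear (0, 0, 0, f, g) (0, 0, 0, f', g')
    simp only [Prod.mk_add_mk, add_zero] at h
    change x.1 + y.1 = _
    rw [hx, hy]
    exact h.symm
  smul_mem' := by
    rintro r x ⟨f, g, hx⟩
    refine ⟨r • f, r • g, ?_⟩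
    have h := map_smul normalFormLinear r (0, 0, 0, f, g)
    simp only [Prod.smul_mk, smul_zero] at h
    change r • x.1 = _
    rw [hx]
    exact h.symm
  lie_mem := by
    rintro ⟨_, c, rfl⟩ y ⟨f, g, hy⟩
    have h : ⁅normalForm c, y.1⁆ = normalForm (bracketParams c (0, 0, 0, f, g)) := by
      rw [hy, bracket_normalForm]
    -- The first three entries of `bracketParams` are zero by definition, whatever its arguments.
    exact ⟨_, _, h⟩

/-- All commutators lie in `abelianIdeal`, and `bracketParams` vanishes when both fields have no
`∂_t` and `∂_y` part; hence the second derived algebra is zero. -/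
theorem isSolvable_normalFormAlgebra : LieAlgebra.IsSolvable normalFormAlgebra := by
  refine (LieAlgebra.isSolvable_iff ℝ normalFormAlgebra).2 ⟨2, ?_⟩
  have h1 : LieAlgebra.derivedSeries ℝ normalFormAlgebra 1 ≤ abelianIdeal := by
    rw [LieAlgebra.derivedSeries_def, LieAlgebra.derivedSeriesOfIdeal_succ,
      LieSubmodule.lie_le_iff]
    rintro ⟨_, c, rfl⟩ - ⟨_, d, rfl⟩ -
    exact ⟨_, _, bracket_normalForm c d⟩
  have h2 : ⁅abelianIdeal, abelianIdeal⁆ ≤ (⊥ : LieIdeal ℝ normalFormAlgebra) := by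
    rw [LieSubmodule.lie_le_iff]
    rintro x ⟨f, g, hx⟩ y ⟨f', g', hy⟩
    rw [LieSubmodule.mem_bot]
    ext1
    change ⁅x.1, y.1⁆ = 0
    rw [hx, hy, bracket_normalForm]
    convert map_zero normalFormLinear using 1
    change normalForm _ = normalForm _
    congr 1
    simp [bracketParams]
  rw [LieAlgebra.derivedSeries_def, LieAlgebra.derivedSeriesOfIdeal_succ, eq_bot_iff]
  exact (LieSubmodule.mono_lie h1 h1).trans h2

end TwoLayer
end

theorem mainTheorem2 (F β : ℝ) (hFβ : F * β ≠ 0) :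
    ∃ 𝔤 : LieSubalgebra ℝ TwoLayer.VField,
      (∀ v : TwoLayer.VField, v ∈ 𝔤 ↔ TwoLayer.IsLieSymmetry F β v) ∧
      𝔤.toSubmodule = Submodule.span ℝ
        ({TwoLayer.fieldT, TwoLayer.fieldY, TwoLayer.fieldF} ∪
          Set.range TwoLayer.fieldX ∪ Set.range TwoLayer.fieldZ) ∧
      (∀ v ∈ 𝔤, ∃! c : ℝ × ℝ × ℝ × TwoLayer.smoothFunctions × TwoLayer.smoothFunctions,
        v = c.1 • TwoLayer.fieldT + c.2.1 • TwoLayer.fieldY + c.2.2.1 • TwoLayer.fieldF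
          + TwoLayer.fieldX c.2.2.2.1 + TwoLayer.fieldZ c.2.2.2.2) ∧
      ¬ FiniteDimensional ℝ 𝔤 ∧
      LieAlgebra.IsSolvable 𝔤 := by
  refine ⟨TwoLayer.normalFormAlgebra, fun v => ?_, TwoLayer.normalFormAlgebra_eq_span,
    fun v hv => ?_, TwoLayer.not_finiteDimensional_normalFormAlgebra,
    TwoLayer.isSolvable_normalFormAlgebra⟩
  · rw [TwoLayer.mem_normalFormAlgebra,
      TwoLayer.isLieSymmetry_iff (left_ne_zero_of_mul hFβ) (right_ne_zero_of_mul hFβ)]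
  · obtain ⟨c, rfl⟩ := TwoLayer.mem_normalFormAlgebra.1 hv
    exact ⟨c, rfl, fun d hd => TwoLayer.normalForm_injective hd.symm⟩
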